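/- **Setting.** Let $k\ge 1$. A *$k$-mixture source on $[0,1]$* is $\theta=(\vartheta,(q^1,\dots,q^k))$ with $\vartheta\in\mathbb{R}_{\ge 0}^k$, $\sum_j\vartheta_j=1$, and each $q^j$ a Borel probability distribution on $[0,1]$. Let $\alpha_j\in[0,1]$ be the mean of $q^j$ and $\tau=\min_{j\ne j'}|\alpha_j-\alpha_{j'}|$ (with $\tau=\infty$ if $k=1$). An *$m$-snapshot* from $\theta$ is obtained by choosing $j\in\{1,\dots,k\}$ with probability $\vartheta_j$ and then drawing $m$ independent points from $q^j$. A *$k$-spike distribution on $[0,1]$* is given by $k$ distinct points of $[0,1]$ with positive weights of sum $1$. For distributions with weights $w_i$ at points $x_i$ and weights $v_j$ at points $y_j$, the *transportation distance* is $$\mathrm{Tran}(w,x;v,y)=\min\Big\{\sum_{i,j}c_{ij}|x_i-y_j| \;:\; c_{ij}\ge 0,\ \sum_j c_{ij}=w_i\ \forall i,\ \sum_i c_{ij}=v_j\ \forall j\Big\}.$$ **Machine model.** A deterministic random access machine over the natural numbers with addition and truncated subtraction, comparison tests, indirect memory access, and unit cost per instruction and per test. It is given $k$ and the number $N$ of snapshots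 as integers. It accesses each real input (the parameters $s,\psi$ and the coordinates of the snapshots) by an instruction that returns $\lfloor m x\rfloor$ for a real input $x$ and a natural number $m$ that the machine has computed. It outputs rational numbers, as numerators over a common denominator. **Theorem.** There are a single program for this machine and a polynomial $P$ such that the following holds for all integers $k\ge 1$ and all reals $s>0$, $\psi>0$. Put $$N=\max\Big\{0,\Big\lceil 3k\,2^{4k}s^{-4k}\ln\frac{4k}{\psi}\Big\rceil\Big\}.$$ On input $k$, $N$, $s$, $\psi$ and any $N$ points of $[0,1]^{2k-1}$, the program halts after at most $P(k+N)$ steps and outputs a $k$-spike distribution $(\tilde\vartheta,\tilde\alpha)$ on $[0,1]$. Moreover, for every $k$-mixture source $\theta$ on $[0,1]$ with $s<\tau$, if the input points are $N$ independent $(2k-1)$-snapshots from $\theta$, then with probability at least $1-\psi$ $$\mathrm{Tran}(\vartheta,\alpha;\tilde\vartheta,\tilde\alpha)\le 1024\,k\,s^{1/(4k)}.$$ -/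

import Mathlib

open MeasureTheory Set

/-! ### Mixture sources on `[0,1]`, snapshots, spike distributions -/

/-- A `k`-mixture source on `[0,1]`: weights in the standard simplex and `k` constituents, each a
Borel probability distribution on `[0,1]`. -/
structure MixtureSource (k : ℕ) where
  weight : Fin k → ℝ
  weight_mem : weight ∈ stdSimplex ℝ (Fin k)
  constituent : Fin k → ProbabilityMeasure unitInterval

namespace MixtureSource

variable {k : ℕ}

/-- The expectation of the `j`-th constituent; `(weight, mean)` is the spike distribution that
corresponds to the source. -/
noncomputable def mean (θ : MixtureSource k) (j : Fin k) : ℝ :=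
  ∫ x : unitInterval, (x : ℝ) ∂(θ.constituent j : Measure unitInterval)

/-- The minimum of `|mean j - mean j'|` over `j ≠ j'` (the empty minimum, for `k = 1`, is `∞`). -/
noncomputable def separation (θ : MixtureSource k) : ENNReal :=
  ⨅ (j : Fin k) (j' : Fin k) (_ : j ≠ j'), ENNReal.ofReal |θ.mean j - θ.mean j'|

/-- The law of an `m`-snapshot: a constituent is chosen according to the weights, and then `m`
independent points are drawn from it. -/
noncomputable def snapshotLaw (θ : MixtureSource k) (m : ℕ) :
    Measure (Fin m → unitInterval) :=
  ∑ j : Fin k, ENNReal.ofReal (θ.weight j) •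
    Measure.pi (fun _ : Fin m => (θ.constituent j : Measure unitInterval))

/-- The law of `N` independent `m`-snapshots. -/
noncomputable def sampleLaw (θ : MixtureSource k) (m N : ℕ) :
    Measure (Fin N → Fin m → unitInterval) :=
  Measure.pi (fun _ : Fin N => θ.snapshotLaw m)

end MixtureSource

/-- `(w, α)` is a `k`-spike distribution on `[0,1]`: a probability distribution that puts positive
mass `w j` on each of the `k` distinct points `α j` of `[0,1]`. -/
def IsSpikeDistribution {k : ℕ} (w α : Fin k → ℝ) : Prop :=
  (∀ j, 0 < w j) ∧ ∑ j, w j = 1 ∧ Function.Injective α ∧ ∀ j, α j ∈ Icc (0 : ℝ) 1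

/-- Transportation distance between the distributions with weights `w` at the points `α` and
weights `v` at the points `β`: the optimum value of the transportation linear program. -/
noncomputable def transportDist {k l : ℕ} (w α : Fin k → ℝ) (v β : Fin l → ℝ) : ℝ :=
  sInf {c : ℝ | ∃ x : Fin k → Fin l → ℝ,
    (∀ i j, 0 ≤ x i j) ∧ (∀ i, ∑ j, x i j = w i) ∧ (∀ j, ∑ i, x i j = v j) ∧
    c = ∑ i, ∑ j, x i j * |α i - β j|}

/-- The number of snapshots, `3 k 2^(4k) s^(-4k) ln (4k/ψ)` rounded up to a natural number. -/
noncomputable def snapshotCount (k : ℕ) (s ψ : ℝ) : ℕ :=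
  ⌈3 * (k : ℝ) * 2 ^ (4 * k) * (s ^ (4 * k))⁻¹ * Real.log (4 * (k : ℝ) / ψ)⌉₊

/-! ### The machine model

A random access machine with natural-number registers and a natural-number memory. Its only
arithmetic is addition and truncated subtraction, so that a number grows by at most a factor of two
per instruction and the unit-cost running time is polynomially related to that of a Turing machine.
Real inputs are not stored: the machine reads them to a finite precision of its choice, by asking
for `⌊m * x⌋`. -/

namespace RAM

/-- Machine state: registers (a program mentions finitely many) and memory. -/
structure State where
  reg : ℕ → ℕ
  mem : ℕ → ℕ

/-- Elementary instructions; all arguments are register names, except the constant `c`. -/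
inductive Instr where
  | const (d c : ℕ)
  | add (d a b : ℕ)
  | sub (d a b : ℕ)
  | load (d a : ℕ)
  | store (a b : ℕ)
  | read (d a m : ℕ)

/-- Effect of an instruction, the sequence of real inputs being `x`. -/
noncomputable def Instr.exec (x : ℕ → ℝ) : Instr → State → State
  | .const d c, σ => { σ with reg := Function.update σ.reg d c }
  | .add d a b, σ => { σ with reg := Function.update σ.reg d (σ.reg a + σ.reg b) }
  | .sub d a b, σ => { σ with reg := Function.update σ.reg d (σ.reg a - σ.reg b) }
  | .load d a, σ => { σ with reg := Function.update σ.reg d (σ.mem (σ.reg a)) }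
  | .store a b, σ => { σ with mem := Function.update σ.mem (σ.reg a) (σ.reg b) }
  | .read d a m, σ =>
      { σ with reg := Function.update σ.reg d ⌊(σ.reg m : ℝ) * x (σ.reg a)⌋₊ }

/-- Programs: sequences, branches and loops, both of the latter testing `reg a < reg b`. -/
inductive Prog where
  | instr (i : Instr)
  | seq (p q : Prog)
  | ifLT (a b : ℕ) (p q : Prog)
  | whileLT (a b : ℕ) (p : Prog)

/-- `Runs x p σ σ' t`: with real inputs `x`, the program `p` started in the state `σ` halts in the
state `σ'` after exactly `t` steps; every instruction and every test is one step. -/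
inductive Runs (x : ℕ → ℝ) : Prog → State → State → ℕ → Prop where
  | instr (i : Instr) (σ : State) : Runs x (.instr i) σ (i.exec x σ) 1
  | seq {p q : Prog} {σ σ₁ σ₂ : State} {t₁ t₂ : ℕ} :
      Runs x p σ σ₁ t₁ → Runs x q σ₁ σ₂ t₂ → Runs x (.seq p q) σ σ₂ (t₁ + t₂)
  | ifTrue {a b : ℕ} {p q : Prog} {σ σ₁ : State} {t : ℕ} :
      σ.reg a < σ.reg b → Runs x p σ σ₁ t → Runs x (.ifLT a b p q) σ σ₁ (t + 1)
  | ifFalse {a b : ℕ} {p q : Prog} {σ σ₁ : State} {t : ℕ} :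
      ¬ σ.reg a < σ.reg b → Runs x q σ σ₁ t → Runs x (.ifLT a b p q) σ σ₁ (t + 1)
  | whileTrue {a b : ℕ} {p : Prog} {σ σ₁ σ₂ : State} {t₁ t₂ : ℕ} :
      σ.reg a < σ.reg b → Runs x p σ σ₁ t₁ → Runs x (.whileLT a b p) σ₁ σ₂ t₂ →
      Runs x (.whileLT a b p) σ σ₂ (t₁ + t₂ + 1)
  | whileFalse {a b : ℕ} {p : Prog} {σ : State} :
      ¬ σ.reg a < σ.reg b → Runs x (.whileLT a b p) σ σ 1

/-- Initial state: `k` and `N` in registers `0` and `1`, everything else zero. -/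
def init (k N : ℕ) : State where
  reg := fun r => if r = 0 then k else if r = 1 then N else 0
  mem := fun _ => 0

/-- The real inputs: `s`, `ψ`, and then the `N` snapshots one after the other. -/
noncomputable def realInput (s ψ : ℝ) {N m : ℕ} (z : Fin N → Fin m → unitInterval) : ℕ → ℝ
  | 0 => s
  | 1 => ψ
  | n + 2 =>
      if h : n / m < N ∧ n % m < m then (z ⟨n / m, h.1⟩ ⟨n % m, h.2⟩ : ℝ) else 0

/-- Weight `j` written in the memory on halting: memory cell `0` holds a common denominator, cells
`1, …, k` hold the numerators of the weights. -/
noncomputable def outWeight (k : ℕ) (σ : State) (j : Fin k) : ℝ :=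
  (σ.mem (1 + j) : ℝ) / (σ.mem 0 : ℝ)

/-- Spike location `j` written in the memory on halting: cells `k+1, …, 2k` hold the numerators of
the locations, over the common denominator in cell `0`. -/
noncomputable def outSpike (k : ℕ) (σ : State) (j : Fin k) : ℝ :=
  (σ.mem (1 + k + j) : ℝ) / (σ.mem 0 : ℝ)

/-- The program `p`, given `k`, `s`, `ψ` and `N` snapshots of aperture `m`, halts after at most `T`
steps, for all values of the snapshots, with output weights `w z` and output locations `α z`. -/
def ComputesWithin (p : Prog) (T k N m : ℕ) (s ψ : ℝ)
    (w α : (Fin N → Fin m → unitInterval) → Fin k → ℝ) : Prop :=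
  ∀ z : Fin N → Fin m → unitInterval, ∃ (σ : State) (t : ℕ),
    t ≤ T ∧ Runs (realInput s ψ z) p (init k N) σ t ∧
    w z = outWeight k σ ∧ α z = outSpike k σ

end RAM

/-! A spike distribution with `k` atoms is determined by its moments of order less than `2 * k`, and
these can be estimated. Given its constituent, the coordinates of a snapshot are independent, so the
product of the first `i` of them has expectation `∑ j, weight j * mean j ^ i`. By Hoeffding's
inequality and a union bound, all `2 * k` empirical moments are accurate with the required
probability.

It remains to find a spike distribution with nearly these moments, and exhaustive search suffices.
With a grid of size `M`, about `1 / s`, there are about `M ^ (2 * k)` candidates, and `N` exceeds `2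
* (2 / s) ^ (2 * k)` whenever the claimed bound is not trivial and `ψ < 1`. Trying every `c ≤ N` is
therefore polynomial in `k + N`. Rounding the true distribution gives an admissible candidate, and
every admissible candidate has moments within `10 * k ^ 2 / M ≤ 10 * k ^ 2 * s` of the true ones
(`exists_candidate`, `RAM.abs_output_moment_sub_le`).

Close moments give a small transportation distance. At a point `t` at distance at least `γ / 2` from
all atoms, the step function at `t` agrees on the atoms with a polynomial of degree less than `2 *
k` and coefficients at most `(4 / γ) ^ (2 * k)` (`exists_step_polynomial`). Its Neville recursion
divides only by distances across the gap at `t`, so atoms on the same side may be arbitrarily close.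
Hence the distribution functions nearly agree at `t`. Near the atoms they differ by at most `1`, on
a set of measure at most `2 * k * γ`. The quantile coupling bounds the transportation distance by
the integral of the difference, and `γ = 256 * s ^ (1 / (4 * k))` balances the two contributions.

For the machine, the search is written in a small expression language whose terms carry both their
value and a time bound `L ^ c`, where `L = k + N + 2` and `c` is a fixed numeral. -/

namespace RAM

/-! ### A functional expression language compiled to the machine

A `Code` produces, for each `d`, a program that leaves a value in register `d` and uses only the
registers from `d` on, and no memory. -/

/-- Program generators, the argument being the number of registers in use. -/
abbrev Code := ℕ → Prog

/-- The contents of the first `depth` registers. -/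
structure World where
  depth : ℕ
  env : ℕ → ℕ

/-- `w'` has at least the registers of `w` in use, with the same contents in the common ones. -/
def World.Extends (w w' : World) : Prop :=
  w.depth ≤ w'.depth ∧ ∀ r < w.depth, w'.env r = w.env r

/-- In every state that extends `w`, the code `e` computes the value `v` in time `L ^ c`. -/
def Denotes (x : ℕ → ℝ) (L : ℕ) (w : World) (e : Code) (v c : ℕ) : Prop :=
  ∀ d σ, w.depth ≤ d → (∀ r < w.depth, σ.reg r = w.env r) →
    ∃ σ' t, t ≤ L ^ c ∧ Runs x (e d) σ σ' t ∧ σ'.mem = σ.mem ∧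
      (∀ r < d, σ'.reg r = σ.reg r) ∧ σ'.reg d = v

/-- The natural number `n`. -/
def lit (n : ℕ) : Code := fun d => .instr (.const d n)

/-- The contents of register `r`. -/
def var (r : ℕ) : Code := fun d => .seq (.instr (.const d 0)) (.instr (.add d r d))

/-- Addition. -/
def addC (e f : Code) : Code := fun d => .seq (e d) (.seq (f (d + 1)) (.instr (.add d d (d + 1))))

/-- Truncated subtraction. -/
def subC (e f : Code) : Code := fun d => .seq (e d) (.seq (f (d + 1)) (.instr (.sub d d (d + 1))))

/-- The real input with index `e`, read with precision `f`. -/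
def readC (e f : Code) : Code := fun d => .seq (e d) (.seq (f (d + 1)) (.instr (.read d d (d + 1))))

/-- If `e₁ < e₂` then `e₃` else `e₄`. -/
def iteC (e₁ e₂ e₃ e₄ : Code) : Code := fun d =>
  .seq (e₁ d) (.seq (e₂ (d + 1)) (.ifLT d (d + 1) (e₃ d) (e₄ d)))

/-- The loop `acc := init; for i < n do acc := body i acc`. -/
def loopC (n init : Code) (body : Code → Code → Code) : Code := fun d =>
  -- Register `d` is the accumulator, `d + 1` the bound, `d + 2` the counter and `d + 3` the
  -- constant one; the body works from `d + 4` on.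
  .seq (init d) (.seq (n (d + 1)) (.seq (.instr (.const (d + 2) 0))
    (.seq (.instr (.const (d + 3) 1)) (.whileLT (d + 2) (d + 1) (.seq (body (var (d + 2)) (var d) (d + 4))
      (.seq (.instr (.const d 0)) (.seq (.instr (.add d d (d + 4)))
        (.instr (.add (d + 2) (d + 2) (d + 3))))))))))

/-- Multiplication by repeated addition of the second factor. -/
def mulC (e f : Code) : Code := loopC e (lit 0) fun _ acc => addC acc f

/-- The sum of `body i` over `i < n`. -/
def sumC (n : Code) (body : Code → Code) : Code := loopC n (lit 0) fun i acc => addC acc (body i)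

/-- The product of `body i` over `i < n`. -/
def prodC (n : Code) (body : Code → Code) : Code := loopC n (lit 1) fun i acc => mulC (body i) acc

/-- Powers. -/
def powC (e n : Code) : Code := prodC n fun _ => e

/-- The greatest `i ≤ n` with `g i < h i`, and `0` if there is none. -/
def greatestC (n : Code) (g h : Code → Code) : Code := loopC n (lit 0) fun i acc =>
  iteC (g (addC i (lit 1))) (h (addC i (lit 1))) (addC i (lit 1)) acc

/-- The quotient `e / f`. -/
def divC (e f : Code) : Code := greatestC e (fun q => mulC q f) fun _ => addC e (lit 1)

theorem World.Extends.refl (w : World) : w.Extends w := ⟨le_rfl, fun _ _ => rfl⟩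

theorem World.Extends.trans {u v w : World} (h : u.Extends v) (h' : v.Extends w) : u.Extends w :=
  ⟨h.1.trans h'.1, fun r hr => (h'.2 r (hr.trans_le h.1)).trans (h.2 r hr)⟩

/-! ### Correctness and cost of the expression language -/

section

variable {x : ℕ → ℝ} {L : ℕ} {w : World}

/-- Loop bodies run with more registers in use than the surrounding code; this carries the
specification of a subterm into them. -/
theorem Denotes.mono {w' : World} {e : Code} {v c : ℕ} (h : Denotes x L w e v c)
    (hw : w.Extends w') : Denotes x L w' e v c := fun d σ hd hσ =>
  h d σ (hw.1.trans hd) fun r hr => (hσ r (hr.trans_le hw.1)).trans (hw.2 r hr)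

theorem Denotes.weaken (hL : 2 ≤ L) {e : Code} {v c c' : ℕ} (h : Denotes x L w e v c)
    (hc : c ≤ c') : Denotes x L w e v c' := fun d σ hd hσ => by
  obtain ⟨σ', t, ht, H⟩ := h d σ hd hσ
  exact ⟨σ', t, ht.trans (Nat.pow_le_pow_right (by omega) hc), H⟩

theorem denotes_lit (n : ℕ) : Denotes x L w (lit n) n 0 := fun d σ _ _ =>
  ⟨_, 1, by simp, .instr _ _, rfl, fun r hr => by simp [Instr.exec, hr.ne], by simp [Instr.exec]⟩

theorem denotes_var (hL : 2 ≤ L) {r : ℕ} (hr : r < w.depth) :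
    Denotes x L w (var r) (w.env r) 1 := fun d σ hd hσ =>
  ⟨_, _, by simpa using hL, .seq (.instr _ _) (.instr _ _), rfl,
    fun r hr => by simp [Instr.exec, hr.ne], by
      have : r ≠ d := by omega
      simp [Instr.exec, this, hσ r hr]⟩

/-- The run of two codes one after the other, in consecutive registers. -/
theorem Denotes.seq_run {e f : Code} {u v a b : ℕ} (he : Denotes x L w e u a)
    (hf : Denotes x L w f v b) (d : ℕ) (σ : State) (hd : w.depth ≤ d)
    (hσ : ∀ r < w.depth, σ.reg r = w.env r) {q : Prog} {σ₂ : State → State} {T : ℕ}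
    (hq : ∀ τ : State, ∃ t ≤ T, Runs x q τ (σ₂ τ) t ∧ (σ₂ τ).mem = τ.mem ∧
      ∀ r < d, (σ₂ τ).reg r = τ.reg r) :
    ∃ τ t, t ≤ L ^ a + L ^ b + T ∧ Runs x (.seq (e d) (.seq (f (d + 1)) q)) σ (σ₂ τ) t ∧
      (σ₂ τ).mem = σ.mem ∧ (∀ r < d, (σ₂ τ).reg r = σ.reg r) ∧ τ.reg d = u ∧ τ.reg (d + 1) = v := by
  obtain ⟨σ₁, t₁, ht₁, r₁, m₁, f₁, v₁⟩ := he d σ hd hσ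
  obtain ⟨τ, t₂, ht₂, r₂, m₂, f₂, v₂⟩ := hf (d + 1) σ₁ (by omega) fun r hr =>
    (f₁ r (by omega)).trans (hσ r hr)
  have hτ : ∀ r < d, τ.reg r = σ.reg r := fun r hr => (f₂ r (by omega)).trans (f₁ r hr)
  have hτd : τ.reg d = u := (f₂ d (by omega)).trans v₁
  obtain ⟨t₃, ht₃, r₃, m₃, f₃⟩ := hq τ
  exact ⟨τ, _, by omega, .seq r₁ (.seq r₂ r₃), by rw [m₃, m₂, m₁],
    fun r hr => (f₃ r hr).trans (hτ r hr), hτd, v₂⟩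

/-- Since `L ≥ 2`, a bounded number of summands costs only a constant in the exponent. Exponents
thus depend on the term alone, not on `k` or `N`. -/
theorem pow_add_pow_add_one_le (hL : 2 ≤ L) (a b : ℕ) : L ^ a + L ^ b + 1 ≤ L ^ (a + b + 2) := by
  have h1 : 1 ≤ L ^ a := Nat.one_le_pow _ _ (by omega)
  have h2 : 1 ≤ L ^ b := Nat.one_le_pow _ _ (by omega)
  have h3 : 4 ≤ L ^ 2 := by nlinarith
  rw [pow_add, pow_add]
  have h4 : L ^ a ≤ L ^ a * L ^ b := Nat.le_mul_of_pos_right _ h2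
  have h5 : L ^ b ≤ L ^ a * L ^ b := Nat.le_mul_of_pos_left _ h1
  have h6 := Nat.mul_le_mul_left (L ^ a * L ^ b) h3
  omega

theorem denotes_addC (hL : 2 ≤ L) {e f : Code} {u v a b : ℕ} (he : Denotes x L w e u a)
    (hf : Denotes x L w f v b) : Denotes x L w (addC e f) (u + v) (a + b + 2) :=
  fun d σ hd hσ => by
  obtain ⟨τ, t, ht, hr, hm, hf, hu, hv⟩ := he.seq_run hf d σ hd hσ
    (σ₂ := (Instr.add d d (d + 1)).exec x) (T := 1) fun τ =>
      ⟨1, le_rfl, .instr _ _, rfl, fun r hr => by simp [Instr.exec, hr.ne]⟩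
  exact ⟨_, t, ht.trans (pow_add_pow_add_one_le hL a b), hr, hm, hf, by simp [Instr.exec, hu, hv]⟩

theorem denotes_subC (hL : 2 ≤ L) {e f : Code} {u v a b : ℕ} (he : Denotes x L w e u a)
    (hf : Denotes x L w f v b) : Denotes x L w (subC e f) (u - v) (a + b + 2) :=
  fun d σ hd hσ => by
  obtain ⟨τ, t, ht, hr, hm, hf, hu, hv⟩ := he.seq_run hf d σ hd hσ
    (σ₂ := (Instr.sub d d (d + 1)).exec x) (T := 1) fun τ =>
      ⟨1, le_rfl, .instr _ _, rfl, fun r hr => by simp [Instr.exec, hr.ne]⟩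
  exact ⟨_, t, ht.trans (pow_add_pow_add_one_le hL a b), hr, hm, hf, by simp [Instr.exec, hu, hv]⟩

theorem denotes_readC (hL : 2 ≤ L) {e f : Code} {u v a b : ℕ} (he : Denotes x L w e u a)
    (hf : Denotes x L w f v b) : Denotes x L w (readC e f) ⌊(v : ℝ) * x u⌋₊ (a + b + 2) :=
  fun d σ hd hσ => by
  obtain ⟨τ, t, ht, hr, hm, hf, hu, hv⟩ := he.seq_run hf d σ hd hσ
    (σ₂ := (Instr.read d d (d + 1)).exec x) (T := 1) fun τ =>
      ⟨1, le_rfl, .instr _ _, rfl, fun r hr => by simp [Instr.exec, hr.ne]⟩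
  exact ⟨_, t, ht.trans (pow_add_pow_add_one_le hL a b), hr, hm, hf, by simp [Instr.exec, hu, hv]⟩

theorem denotes_iteC (hL : 2 ≤ L) {e₁ e₂ e₃ e₄ : Code} {v₁ v₂ v₃ v₄ a b c c' : ℕ}
    (h₁ : Denotes x L w e₁ v₁ a) (h₂ : Denotes x L w e₂ v₂ b) (h₃ : Denotes x L w e₃ v₃ c)
    (h₄ : Denotes x L w e₄ v₄ c') :
    Denotes x L w (iteC e₁ e₂ e₃ e₄) (if v₁ < v₂ then v₃ else v₄) (a + b + c + c' + 3) :=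
  fun d σ hd hσ => by
  have ht : L ^ a + L ^ b + (L ^ c + L ^ c' + 1) ≤ L ^ (a + b + c + c' + 3) := by
    have h1 : 1 ≤ L ^ a := Nat.one_le_pow _ _ (by omega)
    have h2 : 1 ≤ L ^ b := Nat.one_le_pow _ _ (by omega)
    have h3 : 1 ≤ L ^ c := Nat.one_le_pow _ _ (by omega)
    have h4 : 1 ≤ L ^ c' := Nat.one_le_pow _ _ (by omega)
    have h5 : 8 ≤ L ^ 3 := (by norm_num : 8 = 2 ^ 3) ▸ Nat.pow_le_pow_left hL 3
    rw [pow_add, pow_add, pow_add, pow_add]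
    have e1 : L ^ a ≤ L ^ a * L ^ b * L ^ c * L ^ c' := by
      rw [mul_assoc, mul_assoc]; exact Nat.le_mul_of_pos_right _ (by positivity)
    have e2 : L ^ b ≤ L ^ a * L ^ b * L ^ c * L ^ c' := by
      rw [mul_assoc, mul_comm (L ^ a), mul_assoc]; exact Nat.le_mul_of_pos_right _ (by positivity)
    have e3 : L ^ c ≤ L ^ a * L ^ b * L ^ c * L ^ c' := by
      rw [mul_comm _ (L ^ c), mul_assoc]; exact Nat.le_mul_of_pos_right _ (by positivity)
    have e4 : L ^ c' ≤ L ^ a * L ^ b * L ^ c * L ^ c' := Nat.le_mul_of_pos_left _ (by positivity)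
    have e5 := Nat.mul_le_mul_left (L ^ a * L ^ b * L ^ c * L ^ c') h5
    omega
  obtain ⟨σ₁, t₁, ht₁, r₁, m₁, f₁, g₁⟩ := h₁ d σ hd hσ
  obtain ⟨τ, t₂, ht₂, r₂, m₂, f₂, g₂⟩ := h₂ (d + 1) σ₁ (by omega) fun r hr =>
    (f₁ r (by omega)).trans (hσ r hr)
  have hτ : ∀ r < d, τ.reg r = σ.reg r := fun r hr => (f₂ r (by omega)).trans (f₁ r hr)
  have hτd : τ.reg d = v₁ := (f₂ d (by omega)).trans g₁
  have hτw : ∀ r < w.depth, τ.reg r = w.env r := fun r hr => (hτ r (by omega)).trans (hσ r hr)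
  by_cases hlt : v₁ < v₂
  · obtain ⟨τ', t₃, ht₃, r₃, m₃, f₃, g₃⟩ := h₃ d τ hd hτw
    exact ⟨τ', _, by omega, .seq r₁ (.seq r₂ (.ifTrue (by rwa [hτd, g₂]) r₃)), by rw [m₃, m₂, m₁],
      fun r hr => (f₃ r hr).trans (hτ r hr), by rw [g₃, if_pos hlt]⟩
  · obtain ⟨τ', t₃, ht₃, r₃, m₃, f₃, g₃⟩ := h₄ d τ hd hτw
    exact ⟨τ', _, by omega, .seq r₁ (.seq r₂ (.ifFalse (by rwa [hτd, g₂]) r₃)), by rw [m₃, m₂, m₁],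
      fun r hr => (f₃ r hr).trans (hτ r hr), by rw [g₃, if_neg hlt]⟩

/-- At most `L ^ q` rounds of cost `L ^ c + 4` keep the total a power of `L`. The body is specified
in every extension of `w` and for arbitrary codes of counter and accumulator, because their values
change from round to round. -/
theorem denotes_loopC (hL : 2 ≤ L) {n init : Code} {body : Code → Code → Code} {m a b c q : ℕ}
    {F : ℕ → ℕ} (hn : Denotes x L w n m a) (hi : Denotes x L w init (F 0) b) (hm : m ≤ L ^ q)
    (hb : ∀ w', w.Extends w' → ∀ i < m, ∀ ei ea, Denotes x L w' ei i 1 →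
      Denotes x L w' ea (F i) 1 → Denotes x L w' (body ei ea) (F (i + 1)) c) :
    Denotes x L w (loopC n init body) (F m) (a + b + q + c + 4) := fun d σ hd hσ => by
  obtain ⟨σ₁, t₁, ht₁, r₁, m₁, f₁, v₁⟩ := hi d σ hd hσ
  obtain ⟨σ₂, t₂, ht₂, r₂, m₂, f₂, v₂⟩ := hn (d + 1) σ₁ (by omega) fun r hr =>
    (f₁ r (by omega)).trans (hσ r hr)
  have hloop : ∀ j i (τ : State), i + j = m → (∀ r < d, τ.reg r = σ.reg r) → τ.reg d = F i →
      τ.reg (d + 1) = m → τ.reg (d + 2) = i → τ.reg (d + 3) = 1 →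
      ∃ τ' t, t ≤ j * (L ^ c + 4) + 1 ∧ Runs x (.whileLT (d + 2) (d + 1)
        (.seq (body (var (d + 2)) (var d) (d + 4))
      (.seq (.instr (.const d 0)) (.seq (.instr (.add d d (d + 4)))
        (.instr (.add (d + 2) (d + 2) (d + 3))))))) τ τ' t ∧ τ'.mem = τ.mem ∧
        (∀ r < d, τ'.reg r = σ.reg r) ∧ τ'.reg d = F m := by
    intro j
    induction j with
    | zero =>
      intro i τ hij hτ h0 h1 h2 h3
      exact ⟨τ, 1, by omega, .whileFalse (by omega), rfl, hτ, by rw [h0, ← hij, add_zero]⟩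
    | succ j ih =>
      intro i τ hij hτ h0 h1 h2 h3
      -- Declaring all registers below `d + 4` in use protects the loop variables from the body and
      -- lets it read them.
      have hw : w.Extends ⟨d + 4, τ.reg⟩ := ⟨Nat.le_add_right_of_le hd, fun r hr =>
        (hτ r (by omega)).trans (hσ r hr)⟩
      have hei := denotes_var (x := x) (w := ⟨d + 4, τ.reg⟩) hL (r := d + 2) (by simp)
      have hea := denotes_var (x := x) (w := ⟨d + 4, τ.reg⟩) hL (r := d) (by simp)
      simp only [h2, h0] at hei hea
      obtain ⟨τ₁, s₁, hs₁, q₁, n₁, g₁, u₁⟩ := hb _ hw i (by omega) _ _ hei hea (d + 4) τ le_rfl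
        fun _ _ => rfl
      have q₂ : Runs x (.seq (.instr (.const d 0)) (.seq (.instr (.add d d (d + 4)))
        (.instr (.add (d + 2) (d + 2) (d + 3))))) τ₁ _ _ :=
        .seq (.instr _ _) (.seq (.instr _ _) (.instr _ _))
      obtain ⟨τ', s, hs, q', n', g', u'⟩ := ih (i + 1)
        ((Instr.add (d + 2) (d + 2) (d + 3)).exec x ((Instr.add d d (d + 4)).exec x
          ((Instr.const d 0).exec x τ₁))) (by omega)
        (fun r hr => by
          have h1 : r ≠ d := by omega
          have h2 : r ≠ d + 2 := by omega
          simpa [Instr.exec, h1, h2] using (g₁ r (by omega)).trans (hτ r hr))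
        (by simp [Instr.exec, u₁])
        (by simpa [Instr.exec] using (g₁ (d + 1) (by omega)).trans h1)
        (by simp [Instr.exec, g₁ (d + 2) (by omega), g₁ (d + 3) (by omega), h2, h3])
        (by simpa [Instr.exec] using (g₁ (d + 3) (by omega)).trans h3)
      refine ⟨τ', _, ?_, .whileTrue (by omega) (.seq q₁ q₂) q', n'.trans n₁, g', u'⟩
      rw [Nat.succ_mul]
      omega
  obtain ⟨τ', t, ht, hr, hmem, hf, hv⟩ := hloop m 0
    ((Instr.const (d + 3) 1).exec x ((Instr.const (d + 2) 0).exec x σ₂)) (by omega)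
    (fun r hr => by
      have h1 : r ≠ d + 2 := by omega
      have h2 : r ≠ d + 3 := by omega
      simpa [Instr.exec, h1, h2] using (f₂ r (by omega)).trans (f₁ r hr))
    (by simpa [Instr.exec] using (f₂ d (by omega)).trans v₁)
    (by simpa [Instr.exec] using v₂) (by simp [Instr.exec]) (by simp [Instr.exec])
  refine ⟨τ', _, ?_, .seq r₁ (.seq r₂ (.seq (.instr _ _) (.seq (.instr _ _) hr))), ?_, hf, hv⟩
  · have h1 : 1 ≤ L ^ a := Nat.one_le_pow _ _ (by omega)
    have h2 : 1 ≤ L ^ b := Nat.one_le_pow _ _ (by omega)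
    have h3 : 1 ≤ L ^ q := Nat.one_le_pow _ _ (by omega)
    have h4 : 1 ≤ L ^ c := Nat.one_le_pow _ _ (by omega)
    have h5 : 16 ≤ L ^ 4 := (by norm_num : 16 = 2 ^ 4) ▸ Nat.pow_le_pow_left hL 4
    have h6 : m * (L ^ c + 4) ≤ L ^ q * (5 * L ^ c) := Nat.mul_le_mul hm (by omega)
    have h7 : L ^ q * (5 * L ^ c) = 5 * (L ^ q * L ^ c) := by ring
    rw [pow_add, pow_add, pow_add, pow_add]
    set A := L ^ a
    set B := L ^ b
    set Q := L ^ q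
    set C := L ^ c
    have e0 : Q * C ≤ A * B * Q * C := by
      rw [mul_assoc (A * B)]; exact Nat.le_mul_of_pos_left _ (by positivity)
    have e1 : A ≤ A * B * Q * C := by
      rw [mul_assoc, mul_assoc]; exact Nat.le_mul_of_pos_right _ (by positivity)
    have e2 : B ≤ A * B * Q * C := by
      rw [mul_assoc, mul_comm A, mul_assoc]; exact Nat.le_mul_of_pos_right _ (by positivity)
    have e5 := Nat.mul_le_mul_left (A * B * Q * C) h5
    omega
  · rw [hmem]
    exact m₂.trans m₁

/-- Only the first factor has to be polynomially bounded, since it counts the additions. The second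
may be exponentially large, as powers of the grid size are; products therefore keep the small factor
on the left. -/
theorem denotes_mulC (hL : 2 ≤ L) {e f : Code} {u v a b q : ℕ} (he : Denotes x L w e u a)
    (hf : Denotes x L w f v b) (hu : u ≤ L ^ q) :
    Denotes x L w (mulC e f) (u * v) (a + b + q + 7) := by
  have := denotes_loopC (x := x) (init := lit 0) (b := 0) (F := fun i => i * v)
    (body := fun _ acc => addC acc f) (c := b + 3) hL he
    (by simpa using denotes_lit (x := x) (L := L) (w := w) 0) hu
    fun w' hw i _ ei ea _ ha => by
      have := denotes_addC hL ha (hf.mono hw)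
      rw [Nat.succ_mul]
      exact this.weaken hL (by omega)
  exact this.weaken hL (by omega)

theorem denotes_sumC (hL : 2 ≤ L) {n : Code} {body : Code → Code} {m a c q : ℕ} {f : ℕ → ℕ}
    (hn : Denotes x L w n m a) (hm : m ≤ L ^ q)
    (hb : ∀ w', w.Extends w' → ∀ i < m, ∀ ei, Denotes x L w' ei i 1 →
      Denotes x L w' (body ei) (f i) c) :
    Denotes x L w (sumC n body) (∑ i ∈ Finset.range m, f i) (a + q + c + 7) := by
  have := denotes_loopC (x := x) (init := lit 0) (b := 0)
    (F := fun i => ∑ i ∈ Finset.range i, f i)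
    (body := fun i acc => addC acc (body i)) (c := c + 3) hL hn
    (by simpa using denotes_lit (x := x) (L := L) (w := w) 0) hm
    fun w' hw i hi ei ea he ha => by
      have := denotes_addC hL ha (hb w' hw i hi ei he)
      rw [Finset.sum_range_succ]
      exact this.weaken hL (by omega)
  exact this.weaken hL (by omega)

theorem denotes_prodC (hL : 2 ≤ L) {n : Code} {body : Code → Code} {m a c q q' : ℕ} {f : ℕ → ℕ}
    (hn : Denotes x L w n m a) (hm : m ≤ L ^ q) (hf : ∀ i < m, f i ≤ L ^ q')
    (hb : ∀ w', w.Extends w' → ∀ i < m, ∀ ei, Denotes x L w' ei i 1 →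
      Denotes x L w' (body ei) (f i) c) :
    Denotes x L w (prodC n body) (∏ i ∈ Finset.range m, f i) (a + q + c + q' + 12) := by
  have := denotes_loopC (x := x) (init := lit 1) (b := 0)
    (F := fun i => ∏ i ∈ Finset.range i, f i)
    (body := fun i acc => mulC (body i) acc) (c := c + q' + 8) hL hn
    (by simpa using denotes_lit (x := x) (L := L) (w := w) 1) hm
    fun w' hw i hi ei ea he ha => by
      have := denotes_mulC hL (hb w' hw i hi ei he) ha (hf i hi)
      rw [Finset.prod_range_succ, mul_comm]
      exact this.weaken hL (by omega)
  exact this.weaken hL (by omega)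

theorem denotes_powC (hL : 2 ≤ L) {e n : Code} {u m a b q q' : ℕ} (he : Denotes x L w e u a)
    (hn : Denotes x L w n m b) (hm : m ≤ L ^ q) (hu : u ≤ L ^ q') :
    Denotes x L w (powC e n) (u ^ m) (a + b + q + q' + 12) := by
  have := denotes_prodC (body := fun _ => e) (f := fun _ => u) hL hn hm (fun _ _ => hu)
    fun w' hw _ _ _ _ => he.mono hw
  rw [Finset.prod_const, Finset.card_range] at this
  exact this.weaken hL (by omega)

theorem denotes_greatestC (hL : 2 ≤ L) {n : Code} {g h : Code → Code} {m a c c' q : ℕ}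
    {G H : ℕ → ℕ} (hn : Denotes x L w n m a) (hm : m ≤ L ^ q)
    (hg : ∀ w', w.Extends w' → ∀ i ≤ m, ∀ ei, Denotes x L w' ei i 3 →
      Denotes x L w' (g ei) (G i) c)
    (hh : ∀ w', w.Extends w' → ∀ i ≤ m, ∀ ei, Denotes x L w' ei i 3 →
      Denotes x L w' (h ei) (H i) c') :
    Denotes x L w (greatestC n g h) (Nat.findGreatest (fun i => G i < H i) m)
      (a + q + c + c' + 11) := by
  have := denotes_loopC (x := x) (init := lit 0) (b := 0)
    (F := Nat.findGreatest (fun i => G i < H i))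
    (body := fun i acc => iteC (g (addC i (lit 1))) (h (addC i (lit 1))) (addC i (lit 1)) acc)
    (c := c + c' + 7) hL hn
    (by simpa using denotes_lit (x := x) (L := L) (w := w) 0) hm
    fun w' hw i hi ei ea he ha => by
      have h1 := denotes_addC hL he (denotes_lit 1)
      rw [Nat.findGreatest_succ]
      exact (denotes_iteC hL (hg w' hw (i + 1) hi _ h1) (hh w' hw (i + 1) hi _ h1) h1 ha).weaken
        hL (by omega)
  exact this.weaken hL (by omega)

/-- Division by linear search; this is affordable because the dividends are candidates, hence at
most `N`. -/
theorem findGreatest_mul_lt (u : ℕ) {v : ℕ} (hv : 0 < v) :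
    Nat.findGreatest (fun q => q * v < u + 1) u = u / v := by
  rw [Nat.findGreatest_eq_iff]
  refine ⟨Nat.div_le_self _ _, fun _ => Nat.lt_succ_of_le (Nat.div_mul_le_self u v),
    fun n hn _ h => ?_⟩
  exact absurd ((Nat.le_div_iff_mul_le hv).2 (Nat.le_of_lt_succ h)) (by omega)

theorem denotes_divC (hL : 2 ≤ L) {e f : Code} {u v a b q : ℕ} (he : Denotes x L w e u a)
    (hf : Denotes x L w f v b) (hu : u ≤ L ^ q) (hv : 0 < v) :
    Denotes x L w (divC e f) (u / v) (2 * a + b + 2 * q + 23) := by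
  have := denotes_greatestC (x := x) (w := w) (g := fun q => mulC q f)
    (h := fun _ => addC e (lit 1)) (G := fun q => q * v) (H := fun _ => u + 1) hL he hu
    (fun w' hw i hi ei hei => denotes_mulC hL hei (hf.mono hw) (hi.trans hu))
    (fun w' hw i hi ei hei => denotes_addC hL (he.mono hw) (denotes_lit 1))
  rw [findGreatest_mul_lt u hv] at this
  exact this.weaken hL (by omega)

end

end RAM

/-! ### The numbers computed by the learning algorithm

A candidate is a natural number `c`, whose digits in base `M` encode weights with denominator `M`
and spike locations with denominator `k * M`. -/

namespace SpikeSearch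

/-- One more than the greatest `m ≤ N` with `m * s < 1`, the real `s` being the input `x 0`. -/
noncomputable def gridSize (N : ℕ) (x : ℕ → ℝ) : ℕ :=
  Nat.findGreatest (fun m => ⌊(m : ℝ) * x 0⌋₊ < 1) N + 1

/-- The digit of `c` at `M ^ l`. -/
def digit (M c l : ℕ) : ℕ := c / M ^ l % M

/-- The `j`-th weight of the candidate `c`, over the denominator `M`. -/
def weight (M c j : ℕ) : ℕ := digit M c j + 1

/-- The `j`-th location of the candidate `c`, over the denominator `k * M`. -/
def location (k M c j : ℕ) : ℕ := k * digit M c (k + j) + j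

/-- The `i`-th moment of the candidate `c`, over the denominator `M * (k * M) ^ i`. -/
def moment (k M c i : ℕ) : ℕ := ∑ j ∈ Finset.range k, weight M c j * location k M c j ^ i

/-- The sum over the snapshots of the products of their first `i` coordinates, each read with
precision `R`. -/
noncomputable def sampleMoment (k N R : ℕ) (x : ℕ → ℝ) (i : ℕ) : ℕ :=
  ∑ z ∈ Finset.range N, ∏ l ∈ Finset.range i, ⌊(R : ℝ) * x (2 + (z * (2 * k - 1) + l))⌋₊

/-- Zero if and only if the candidate `c` has total weight one and approximately the moments of the
sample. -/
noncomputable def defect (k N M : ℕ) (x : ℕ → ℝ) (c : ℕ) : ℕ :=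
  (M - ∑ j ∈ Finset.range k, weight M c j) + (∑ j ∈ Finset.range k, weight M c j - M) +
    ∑ i ∈ Finset.range (2 * k), if 7 * (k * (k * (N * (k * M) ^ i))) <
      (N * moment k M c i - M * sampleMoment k N (k * M) x i) +
      (M * sampleMoment k N (k * M) x i - N * moment k M c i) then 1 else 0

/-- The last candidate without defect. -/
noncomputable def best (k N : ℕ) (x : ℕ → ℝ) : ℕ :=
  Nat.findGreatest (fun c => defect k N (gridSize N x) x c < 1) N

/-- The contents of the memory cell `a ≤ 2 * k` on halting: the best candidate if it has no defect,
and otherwise equal weights at the multiples of `1 / k`. -/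
noncomputable def output (k N : ℕ) (x : ℕ → ℝ) (a : ℕ) : ℕ :=
  if defect k N (gridSize N x) x (best k N x) < 1 then
    if a < 1 then k * gridSize N x
    else if a < k + 1 then k * weight (gridSize N x) (best k N x) (a - 1)
    else location k (gridSize N x) (best k N x) (a - (k + 1))
  else if a < 1 then k else if a < k + 1 then 1 else a - (k + 1)

end SpikeSearch

/-! ### The program -/

namespace RAM

/-- The world in which registers `0` and `1` hold `k` and `N`. -/
def inputWorld (k N : ℕ) : World := ⟨2, (init k N).reg⟩

/-- Code for `2 * k`. -/
def doubleC : Code := mulC (lit 2) (var 0)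

/-- Code for `SpikeSearch.gridSize`. -/
def gridC : Code := addC (greatestC (var 1) (fun m => readC (lit 0) m) fun _ => lit 1) (lit 1)

/-- Code for the denominator of the locations. -/
def denomC : Code := mulC (var 0) gridC

/-- Code for `SpikeSearch.digit`. -/
def digitC (c l : Code) : Code :=
  subC (divC c (powC gridC l)) (mulC gridC (divC c (powC gridC (addC l (lit 1)))))

/-- Code for `SpikeSearch.weight`. -/
def weightC (c j : Code) : Code := addC (digitC c j) (lit 1)

/-- Code for `SpikeSearch.location`. -/
def locationC (c j : Code) : Code := addC (mulC (var 0) (digitC c (addC (var 0) j))) j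

/-- Code for `SpikeSearch.moment`. -/
def momentC (c i : Code) : Code :=
  sumC (var 0) fun j => mulC (weightC c j) (powC (locationC c j) i)

/-- Code for `SpikeSearch.sampleMoment`. -/
def sampleMomentC (i : Code) : Code := sumC (var 1) fun z => prodC i fun l =>
  readC (addC (lit 2) (addC (mulC z (subC doubleC (lit 1))) l)) denomC

/-- Code for `|e - f|`. -/
def distC (e f : Code) : Code := addC (subC e f) (subC f e)

/-- Code for the admissible error of the `i`-th moment. -/
def toleranceC (i : Code) : Code :=
  mulC (lit 7) (mulC (var 0) (mulC (var 0) (mulC (var 1) (powC denomC i))))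

/-- Code for `SpikeSearch.defect`. -/
def defectC (c : Code) : Code :=
  addC (distC gridC (sumC (var 0) fun j => weightC c j)) (sumC doubleC fun i =>
    iteC (toleranceC i) (distC (mulC (var 1) (momentC c i)) (mulC gridC (sampleMomentC i)))
      (lit 1) (lit 0))

/-- Code for `SpikeSearch.best`. -/
def bestC : Code := greatestC (var 1) defectC fun _ => lit 1

/-- Code for `SpikeSearch.output`. -/
def outputC (a : Code) : Code :=
  iteC (defectC bestC) (lit 1)
    (iteC a (lit 1) denomC (iteC a (addC (var 0) (lit 1))
      (mulC (var 0) (weightC bestC (subC a (lit 1))))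
      (locationC bestC (subC a (addC (var 0) (lit 1))))))
    (iteC a (lit 1) (var 0) (iteC a (addC (var 0) (lit 1)) (lit 1)
      (subC a (addC (var 0) (lit 1)))))

/-- The program that writes `F a` to memory cell `a` for all `a < n`. -/
def storeProg (n : Code) (F : Code → Code) : Prog :=
  .seq (.instr (.const 2 0)) (.seq (n 3) (.seq (.instr (.const 4 1))
    (.whileLT 2 3 (.seq (F (var 2) 5) (.seq (.instr (.store 2 5)) (.instr (.add 2 2 4)))))))

/-- The learning algorithm. -/
def learnProg : Prog := storeProg (addC doubleC (lit 1)) outputC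

/-! ### Correctness and running time of the program -/

section

open SpikeSearch

variable {x : ℕ → ℝ} {L k N : ℕ} {w : World}

/-- Codes leave the memory alone, so the loop invariant is that all cells below the counter already
hold their final values. -/
theorem storeProg_runs (hL : 2 ≤ L) {n : Code} {F : Code → Code} {m a c q : ℕ} {f : ℕ → ℕ}
    (hn : Denotes x L (inputWorld k N) n m a) (hm : m ≤ L ^ q)
    (hF : ∀ w', (inputWorld k N).Extends w' → ∀ i < m, ∀ ei, Denotes x L w' ei i 1 →
      Denotes x L w' (F ei) (f i) c) :
    ∃ σ t, t ≤ L ^ (a + q + c + 4) ∧ Runs x (storeProg n F) (init k N) σ t ∧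
      ∀ i < m, σ.mem i = f i := by
  have hσ₀ : ∀ r < 2, ((Instr.const 2 0).exec x (init k N)).reg r = (init k N).reg r :=
    fun r hr => by simp [Instr.exec, hr.ne]
  obtain ⟨σ₂, t₂, ht₂, r₂, m₂, f₂, v₂⟩ := hn 3 ((Instr.const 2 0).exec x (init k N))
    (by simp [inputWorld]) hσ₀
  have hloop : ∀ j i (τ : State), i + j = m → (∀ r < 2, τ.reg r = (init k N).reg r) →
      τ.reg 2 = i → τ.reg 3 = m → τ.reg 4 = 1 → (∀ r < i, τ.mem r = f r) →
      ∃ τ' t, t ≤ j * (L ^ c + 3) + 1 ∧ Runs x (.whileLT 2 3 (.seq (F (var 2) 5)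
        (.seq (.instr (.store 2 5)) (.instr (.add 2 2 4))))) τ τ' t ∧
        ∀ r < m, τ'.mem r = f r := by
    intro j
    induction j with
    | zero =>
      intro i τ hij hτ h2 h3 h4 hmem
      exact ⟨τ, 1, by omega, .whileFalse (by omega), fun r hr => hmem r (by omega)⟩
    | succ j ih =>
      intro i τ hij hτ h2 h3 h4 hmem
      have hw : (inputWorld k N).Extends ⟨5, τ.reg⟩ := ⟨by simp [inputWorld], hτ⟩
      have hei := denotes_var (x := x) (w := ⟨5, τ.reg⟩) hL (r := 2) (by simp)
      simp only [h2] at hei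
      obtain ⟨τ₁, s₁, hs₁, q₁, n₁, g₁, u₁⟩ := hF _ hw i (by omega) _ hei 5 τ le_rfl fun _ _ => rfl
      have h2' : τ₁.reg 2 = i := (g₁ 2 (by omega)).trans h2
      obtain ⟨τ', s, hs, q', u'⟩ := ih (i + 1)
        ((Instr.add 2 2 4).exec x ((Instr.store 2 5).exec x τ₁)) (by omega)
        (fun r hr => by
          have h1 : r ≠ 2 := by omega
          simpa [Instr.exec, h1] using (g₁ r (by omega)).trans (hτ r hr))
        (by simp [Instr.exec, h2', g₁ 4 (by omega), h4])
        (by simpa [Instr.exec] using (g₁ 3 (by omega)).trans h3)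
        (by simpa [Instr.exec] using (g₁ 4 (by omega)).trans h4)
        (fun r hr => by
          rcases Nat.lt_succ_iff_lt_or_eq.1 hr with h | rfl
          · simpa [Instr.exec, h2', h.ne, n₁] using hmem r h
          · simp [Instr.exec, h2', u₁])
      refine ⟨τ', _, ?_, .whileTrue (by omega) (.seq q₁ (.seq (.instr _ _) (.instr _ _))) q', u'⟩
      rw [Nat.succ_mul]
      omega
  obtain ⟨τ', t, ht, hr, hmem⟩ := hloop m 0 ((Instr.const 4 1).exec x σ₂) (by omega)
    (fun r hr => by
      have h1 : r ≠ 4 := by omega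
      simpa [Instr.exec, h1] using (f₂ r (by omega)).trans (hσ₀ r hr))
    (by simpa [Instr.exec] using f₂ 2 (by omega))
    (by simpa [Instr.exec] using v₂) (by simp [Instr.exec]) (by simp)
  refine ⟨τ', _, ?_, .seq (.instr _ _) (.seq r₂ (.seq (.instr _ _) hr)), hmem⟩
  have h1 : 1 ≤ L ^ a := Nat.one_le_pow _ _ (by omega)
  have h3 : 1 ≤ L ^ q := Nat.one_le_pow _ _ (by omega)
  have h4 : 1 ≤ L ^ c := Nat.one_le_pow _ _ (by omega)
  have h5 : 16 ≤ L ^ 4 := (by norm_num : 16 = 2 ^ 4) ▸ Nat.pow_le_pow_left hL 4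
  have h6 : m * (L ^ c + 3) ≤ L ^ q * (4 * L ^ c) := Nat.mul_le_mul hm (by omega)
  have h7 : L ^ q * (4 * L ^ c) = 4 * (L ^ q * L ^ c) := by ring
  rw [pow_add, pow_add, pow_add]
  have e0 : L ^ q * L ^ c ≤ L ^ a * L ^ q * L ^ c := by
    rw [mul_assoc]; exact Nat.le_mul_of_pos_left _ (by positivity)
  have e1 : L ^ a ≤ L ^ a * L ^ q * L ^ c := by
    rw [mul_assoc]; exact Nat.le_mul_of_pos_right _ (by positivity)
  have e5 := Nat.mul_le_mul_left (L ^ a * L ^ q * L ^ c) h5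
  omega

theorem gridSize_le : gridSize N x ≤ N + 1 := Nat.succ_le_succ (Nat.findGreatest_le _)

theorem gridSize_pos : 0 < gridSize N x := Nat.succ_pos _

/-- The form in which `digitC` computes a digit, with division in place of a remainder. -/
theorem digit_eq (M c l : ℕ) : digit M c l = c / M ^ l - M * (c / M ^ (l + 1)) := by
  rw [digit, Nat.mod_def, Nat.div_div_eq_div_mul, pow_succ]

variable (hL : L = k + N + 2) (hw : (inputWorld k N).Extends w)

theorem le_pow_succ_of_le {m : ℕ} (q : ℕ) (hm : m ≤ L) : m ≤ L ^ (q + 1) :=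
  hm.trans (Nat.le_self_pow (by omega) L)

include hL

theorem two_le_of_eq : 2 ≤ L := by omega

theorem le_sq_of_eq {m : ℕ} (hm : m ≤ 2 * (k + N + 2)) : m ≤ L ^ 2 := by
  have := two_le_of_eq hL
  nlinarith

include hw

theorem denotes_k : Denotes x L w (var 0) k 1 := by
  have h := denotes_var (x := x) (w := inputWorld k N) (two_le_of_eq hL) (r := 0)
    (by simp [inputWorld])
  exact h.mono hw

theorem denotes_N : Denotes x L w (var 1) N 1 := by
  have h := denotes_var (x := x) (w := inputWorld k N) (two_le_of_eq hL) (r := 1)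
    (by simp [inputWorld])
  exact h.mono hw

theorem denotes_doubleC : Denotes x L w doubleC (2 * k) 9 :=
  have h := two_le_of_eq hL
  (denotes_mulC h (denotes_lit 2) (denotes_k hL hw) (q := 1) (by simpa)).weaken h (by norm_num)

theorem denotes_gridC : Denotes x L w gridC (gridSize N x) 20 := by
  have h := two_le_of_eq hL
  have h1 := denotes_greatestC (x := x) (w := w) (g := fun m => readC (lit 0) m)
    (h := fun _ => lit 1) (G := fun m => ⌊(m : ℝ) * x 0⌋₊) (H := fun _ => 1) h (denotes_N hL hw)
    (le_pow_succ_of_le 0 (by omega)) (fun w' hw i hi ei hei => denotes_readC h (denotes_lit 0) hei)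
    fun w' hw i hi ei hei => denotes_lit 1
  exact (denotes_addC h h1 (denotes_lit 1)).weaken h (by norm_num)

theorem denotes_denomC : Denotes x L w denomC (k * gridSize N x) 29 :=
  have h := two_le_of_eq hL
  (denotes_mulC h (denotes_k hL hw) (denotes_gridC hL hw) (q := 1)
    (le_pow_succ_of_le 0 (by omega))).weaken h (by norm_num)

theorem denotes_digitC {e f : Code} {c l a b : ℕ} (he : Denotes x L w e c a)
    (hf : Denotes x L w f l b) (hc : c ≤ N) (hl : l ≤ 2 * (k + N)) :
    Denotes x L w (digitC e f) (digit (gridSize N x) c l) (4 * a + 2 * b + 152) := by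
  have h := two_le_of_eq hL
  have hM := denotes_gridC (x := x) hL hw
  have hML : gridSize N x ≤ L := gridSize_le.trans (by omega)
  have h1 := denotes_divC h he (denotes_powC h hM hf (le_sq_of_eq hL (by omega))
    (le_pow_succ_of_le 0 hML)) (le_pow_succ_of_le 0 (by omega)) (pow_pos gridSize_pos _)
  have h2 := denotes_divC h he (denotes_powC h hM (denotes_addC h hf (denotes_lit 1))
    (le_sq_of_eq hL (by omega)) (le_pow_succ_of_le 0 hML)) (le_pow_succ_of_le 0 (by omega))
    (pow_pos gridSize_pos _)
  rw [digit_eq]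
  exact (denotes_subC h h1 (denotes_mulC h hM h2 (le_pow_succ_of_le 0 hML))).weaken h (by omega)

theorem denotes_weightC {e f : Code} {c l a b : ℕ} (he : Denotes x L w e c a)
    (hf : Denotes x L w f l b) (hc : c ≤ N) (hl : l ≤ 2 * k) :
    Denotes x L w (weightC e f) (weight (gridSize N x) c l) (4 * a + 2 * b + 154) :=
  have h := two_le_of_eq hL
  (denotes_addC h (denotes_digitC hL hw he hf hc (by omega)) (denotes_lit 1)).weaken h (by omega)

theorem denotes_locationC {e f : Code} {c l a b : ℕ} (he : Denotes x L w e c a)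
    (hf : Denotes x L w f l b) (hc : c ≤ N) (hl : l ≤ k) :
    Denotes x L w (locationC e f) (location k (gridSize N x) c l) (4 * a + 3 * b + 169) :=
  have h := two_le_of_eq hL
  have hk := denotes_k (x := x) hL hw
  (denotes_addC h (denotes_mulC h hk (denotes_digitC hL hw he (denotes_addC h hk hf) hc
    (by omega)) (le_pow_succ_of_le 0 (by omega))) hf).weaken h (by omega)

omit hL hw in
theorem weight_le (c j : ℕ) : weight (gridSize N x) c j ≤ gridSize N x :=
  Nat.mod_lt _ gridSize_pos

omit hL hw in
theorem location_lt (c : ℕ) {j : ℕ} (hj : j < k) :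
    location k (gridSize N x) c j < k * gridSize N x := by
  have h := weight_le (N := N) (x := x) c (k + j)
  have := Nat.mul_le_mul_left k h
  simp only [weight, location] at *
  rw [Nat.mul_succ] at this
  omega

omit hw in
theorem denom_le : k * gridSize N x ≤ L ^ 2 := by
  rw [pow_two]
  exact Nat.mul_le_mul (by omega) (gridSize_le.trans (by omega))

theorem denotes_momentC {e f : Code} {c i a b : ℕ} (he : Denotes x L w e c a)
    (hf : Denotes x L w f i b) (hc : c ≤ N) (hi : i ≤ 2 * k) :
    Denotes x L w (momentC e f) (moment k (gridSize N x) c i) (8 * a + b + 361) := by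
  have h := two_le_of_eq hL
  have := denotes_sumC (x := x) (w := w) (body := fun j => mulC (weightC e j)
    (powC (locationC e j) f)) h (denotes_k hL hw) (le_pow_succ_of_le 0 (by omega))
    fun w' hw' j hj ej hej => denotes_mulC h (denotes_weightC hL (hw.trans hw') (he.mono hw') hej hc
      (by omega)) (denotes_powC h (denotes_locationC hL (hw.trans hw') (he.mono hw') hej hc hj.le)
      (hf.mono hw') (le_sq_of_eq hL (by omega))
      ((location_lt c hj).le.trans (denom_le hL)))
      (le_pow_succ_of_le 0 ((weight_le c j).trans (gridSize_le.trans (by omega))))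
  exact this.weaken h (by omega)

theorem denotes_sampleMomentC (hx : ∀ n, x (n + 2) ≤ 1) {f : Code} {i b : ℕ}
    (hf : Denotes x L w f i b) (hi : i ≤ 2 * k) :
    Denotes x L w (sampleMomentC f) (sampleMoment k N (k * gridSize N x) x i) (b + 81) := by
  have h := two_le_of_eq hL
  have := denotes_sumC (x := x) (w := w) (body := fun z => prodC f fun l =>
    readC (addC (lit 2) (addC (mulC z (subC doubleC (lit 1))) l)) denomC) h (denotes_N hL hw)
    (le_pow_succ_of_le 0 (by omega)) fun w' hw' z hz ez hez =>
    denotes_prodC h (hf.mono hw') (le_sq_of_eq hL (by omega))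
      (f := fun l => ⌊((k * gridSize N x : ℕ) : ℝ) * x (2 + (z * (2 * k - 1) + l))⌋₊)
      (fun l _ => by
        refine le_trans ?_ (denom_le (x := x) hL)
        refine Nat.floor_le_of_le ?_
        rw [add_comm 2]
        exact mul_le_of_le_one_right (Nat.cast_nonneg _) (hx _))
      fun w'' hw'' l hl el hel => denotes_readC h (denotes_addC h (denotes_lit 2)
        (denotes_addC h (denotes_mulC h (hez.mono hw'') (denotes_subC h
          (denotes_doubleC hL (hw.trans (hw'.trans hw''))) (denotes_lit 1))
          (le_pow_succ_of_le 0 (by omega))) hel)) (denotes_denomC hL (hw.trans (hw'.trans hw'')))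
  exact this.weaken h (by omega)

omit hL hw in
theorem denotes_distC (h : 2 ≤ L) {e f : Code} {u v a b : ℕ} (he : Denotes x L w e u a)
    (hf : Denotes x L w f v b) :
    Denotes x L w (distC e f) ((u - v) + (v - u)) (2 * a + 2 * b + 6) :=
  (denotes_addC h (denotes_subC h he hf) (denotes_subC h hf he)).weaken h (by omega)

theorem denotes_toleranceC {f : Code} {i b : ℕ} (hf : Denotes x L w f i b) (hi : i ≤ 2 * k) :
    Denotes x L w (toleranceC f) (7 * (k * (k * (N * (k * gridSize N x) ^ i)))) (b + 82) := by
  have h := two_le_of_eq hL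
  have hk := denotes_k (x := x) hL hw
  have h7 : 7 ≤ L ^ 3 :=
    (by norm_num : 7 ≤ 2 ^ 3).trans (Nat.pow_le_pow_left h 3)
  exact (denotes_mulC h (denotes_lit 7) (denotes_mulC h hk (denotes_mulC h hk
    (denotes_mulC h (denotes_N hL hw) (denotes_powC h (denotes_denomC hL hw) hf
      (le_sq_of_eq hL (by omega)) (denom_le hL)) (le_pow_succ_of_le 0 (by omega)))
    (le_pow_succ_of_le 0 (by omega))) (le_pow_succ_of_le 0 (by omega))) h7).weaken h (by omega)

theorem denotes_defectC (hx : ∀ n, x (n + 2) ≤ 1) {e : Code} {c a : ℕ}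
    (he : Denotes x L w e c a) (hc : c ≤ N) :
    Denotes x L w (defectC e) (defect k N (gridSize N x) x c) (24 * a + 1450) := by
  have h := two_le_of_eq hL
  have hML : gridSize N x ≤ L := gridSize_le.trans (by omega)
  have h1 := denotes_sumC (x := x) (w := w) (body := fun j => weightC e j) h (denotes_k hL hw)
    (le_pow_succ_of_le 0 (by omega)) fun w' hw' j hj ej hej =>
      denotes_weightC hL (hw.trans hw') (he.mono hw') hej hc (by omega)
  have h2 := denotes_sumC (x := x) (w := w) (body := fun i =>
    iteC (toleranceC i) (distC (mulC (var 1) (momentC e i)) (mulC gridC (sampleMomentC i)))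
      (lit 1) (lit 0)) h (denotes_doubleC hL hw) (le_sq_of_eq hL (by omega))
    fun w' hw' i hi ei hei => denotes_iteC h (denotes_toleranceC hL (hw.trans hw') hei hi.le)
      (denotes_distC h (denotes_mulC h (denotes_N hL (hw.trans hw'))
        (denotes_momentC hL (hw.trans hw') (he.mono hw') hei hc hi.le)
        (le_pow_succ_of_le 0 (by omega)))
        (denotes_mulC h (denotes_gridC hL (hw.trans hw'))
          (denotes_sampleMomentC hL (hw.trans hw') hx hei hi.le) (le_pow_succ_of_le 0 hML)))
      (denotes_lit 1) (denotes_lit 0)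
  exact (denotes_addC h (denotes_distC h (denotes_gridC hL hw) h1) h2).weaken h (by omega)

omit hL hw in
theorem best_le : best k N x ≤ N := Nat.findGreatest_le _

theorem denotes_bestC (hx : ∀ n, x (n + 2) ≤ 1) : Denotes x L w bestC (best k N x) 1535 := by
  have h := two_le_of_eq hL
  have := denotes_greatestC (x := x) (w := w) (g := defectC) (h := fun _ => lit 1)
    (G := defect k N (gridSize N x) x) (H := fun _ => 1) h (denotes_N hL hw)
    (le_pow_succ_of_le 0 (by omega))
    (fun w' hw' c hc ec hec => denotes_defectC hL (hw.trans hw') hx hec hc)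
    fun w' hw' c hc ec hec => denotes_lit 1
  exact this.weaken h (by omega)

omit hL hw in
theorem exists_denotes_outputC : ∃ c, ∀ (x : ℕ → ℝ) (L k N : ℕ) (w : World), L = k + N + 2 →
    (inputWorld k N).Extends w → (∀ n, x (n + 2) ≤ 1) → ∀ (e : Code) (a : ℕ),
    Denotes x L w e a 1 → a < 2 * k + 1 → Denotes x L w (outputC e) (output k N x a) c := by
  -- Any numeral above the accumulated exponent serves; what matters is that it is chosen before
  -- `k`, `N` and the inputs.
  refine ⟨100000, fun x L k N w hL hw hx e a he ha => ?_⟩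
  have h := two_le_of_eq hL
  have hk := denotes_k (x := x) hL hw
  have hb := denotes_bestC hL hw hx
  have h1 := denotes_subC h he (denotes_lit 1)
  have hk1 := denotes_addC h hk (denotes_lit 1)
  have h2 := denotes_subC h he hk1
  exact (denotes_iteC h (denotes_defectC hL hw hx hb best_le) (denotes_lit 1)
    (denotes_iteC h he (denotes_lit 1) (denotes_denomC hL hw) (denotes_iteC h he hk1
      (denotes_mulC h hk (denotes_weightC hL hw hb h1 best_le (by omega))
        (le_pow_succ_of_le 0 (by omega)))
      (denotes_locationC hL hw hb h2 best_le (by omega))))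
    (denotes_iteC h he (denotes_lit 1) hk (denotes_iteC h he hk1 (denotes_lit 1) h2))).weaken h
    (by norm_num)

omit hL hw in
/-- The program `learnProg` computes `SpikeSearch.output` in polynomial time. -/
theorem exists_learnProg_runs : ∃ P : Polynomial ℕ, ∀ (x : ℕ → ℝ) (k N : ℕ),
    (∀ n, x (n + 2) ≤ 1) → ∃ σ t, t ≤ P.eval (k + N) ∧ Runs x learnProg (init k N) σ t ∧
      ∀ a < 2 * k + 1, σ.mem a = output k N x a := by
  obtain ⟨c, hc⟩ := exists_denotes_outputC
  refine ⟨(Polynomial.X + 2) ^ (11 + 2 + c + 4), fun x k N hx => ?_⟩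
  have h : 2 ≤ k + N + 2 := by omega
  obtain ⟨σ, t, ht, hr, hm⟩ := storeProg_runs (x := x) (k := k) (N := N) (m := 2 * k + 1) h
    (denotes_addC h (denotes_doubleC rfl (World.Extends.refl _)) (denotes_lit 1))
    (le_sq_of_eq rfl (by omega)) fun w' hw' i hi ei hei => hc x _ k N w' rfl hw' hx ei i hei hi
  refine ⟨σ, t, ?_, hr, hm⟩
  simpa using ht

end

end RAM

/-! ### Distributions with almost equal moments have almost equal distribution functions -/

/-- Neville interpolation of a step function: if `A` lies to the left of `B` at distance `g`, there
is a polynomial with bounded coefficients that is `1` on `A` and `0` on `B`. -/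
theorem exists_step_polynomial {g : ℝ} (hg : 0 < g) (hg1 : g ≤ 1) (n : ℕ) :
    ∀ A B : Finset ℝ, A.card + B.card ≤ n → (∀ a ∈ A, a ∈ Icc (0 : ℝ) 1) →
      (∀ b ∈ B, b ∈ Icc (0 : ℝ) 1) → (∀ a ∈ A, ∀ b ∈ B, a + g ≤ b) →
      ∃ P : Polynomial ℝ, (∀ i, n ≤ i → P.coeff i = 0) ∧ (∀ i, |P.coeff i| ≤ (4 / g) ^ n) ∧
        (∀ a ∈ A, P.eval a = 1) ∧ ∀ b ∈ B, P.eval b = 0 := by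
  have h4 : 1 ≤ 4 / g := by rw [le_div_iff₀ hg]; linarith
  induction n with
  | zero =>
    intro A B hAB hA hB hgap
    have hA0 : A = ∅ := Finset.card_eq_zero.1 (by omega)
    exact ⟨0, by simp, by simp, by simp [hA0], by simp⟩
  | succ n ih =>
    intro A B hAB hA hB hgap
    have hK := one_le_pow₀ h4 (n := n + 1)
    rcases A.eq_empty_or_nonempty with rfl | ⟨a, ha⟩
    · exact ⟨0, by simp, fun i => by simp; positivity, by simp, by simp⟩
    rcases B.eq_empty_or_nonempty with rfl | ⟨b, hb⟩
    · refine ⟨1, fun i hi => by rw [Polynomial.coeff_one, if_neg (by omega)], fun i => ?_, by simp,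
        by simp⟩
      rw [Polynomial.coeff_one]
      split_ifs
      · simpa using hK
      · simp; positivity
    have hcA := Finset.card_erase_of_mem ha
    have hcB := Finset.card_erase_of_mem hb
    have hpA : 0 < A.card := Finset.card_pos.2 ⟨a, ha⟩
    have hpB : 0 < B.card := Finset.card_pos.2 ⟨b, hb⟩
    obtain ⟨P, hP0, hPK, hPA, hPB⟩ := ih (A.erase a) B (by omega)
      (fun y hy => hA y (Finset.mem_of_mem_erase hy)) hB
      fun y hy => hgap y (Finset.mem_of_mem_erase hy)
    obtain ⟨Q, hQ0, hQK, hQA, hQB⟩ := ih A (B.erase b) (by omega) hA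
      (fun y hy => hB y (Finset.mem_of_mem_erase hy))
      fun y hy z hz => hgap y hy z (Finset.mem_of_mem_erase hz)
    have hab := hgap a ha b hb
    have hne : b - a ≠ 0 := by linarith
    set K := (4 / g) ^ n with hKdef
    have hK0 : 0 ≤ K := by positivity
    have hterm : ∀ y ∈ Icc (0 : ℝ) 1, ∀ c, |c| ≤ K → |c * y| ≤ K := fun y hy c hc => by
      rw [abs_mul, abs_of_nonneg hy.1]
      exact (mul_le_of_le_one_right (abs_nonneg _) hy.2).trans hc
    have hdiv : ∀ s : ℝ, |s| ≤ 4 * K → |1 / (b - a) * s| ≤ (4 / g) ^ (n + 1) := fun s hs => by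
      rw [abs_mul, abs_of_pos (by apply one_div_pos.2; linarith), pow_succ, ← hKdef,
        one_div_mul_eq_div, show K * (4 / g) = 4 * K / g by ring]
      exact div_le_div₀ (by positivity) hs hg (by linarith)
    -- Neville's step, with `P` missing the node `a` and `Q` missing the node `b`. The weights `(X -
    -- a) / (b - a)` and `(b - X) / (b - a)` sum to one, and each vanishes at the node where its
    -- polynomial is uncontrolled. Choosing `a` in `A` and `b` in `B` makes the denominator at least
    -- `g`; a coefficient collects at most four terms of size `K`, whence the factor `4 / g`.
    refine ⟨Polynomial.C (1 / (b - a)) * (P * (Polynomial.X - Polynomial.C a) +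
      Q * (Polynomial.C b - Polynomial.X)), fun i hi => ?_, fun i => ?_, fun y hy => ?_,
      fun y hy => ?_⟩
    · obtain ⟨j, rfl⟩ : ∃ j, i = j + 1 := ⟨i - 1, by omega⟩
      simp [mul_sub, Polynomial.coeff_mul_X, Polynomial.coeff_mul_C, hP0 j (by omega),
        hP0 (j + 1) (by omega), hQ0 j (by omega), hQ0 (j + 1) (by omega)]
    · rw [Polynomial.coeff_C_mul]
      apply hdiv
      cases i with
      | zero =>
        simp only [mul_sub, Polynomial.coeff_add, Polynomial.coeff_sub, Polynomial.coeff_mul_C,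
          Polynomial.coeff_mul_X_zero]
        have h1 := abs_le.1 (hterm a (hA a ha) _ (hPK 0))
        have h2 := abs_le.1 (hterm b (hB b hb) _ (hQK 0))
        rw [abs_le]
        constructor <;> linarith
      | succ j =>
        simp only [mul_sub, Polynomial.coeff_add, Polynomial.coeff_sub, Polynomial.coeff_mul_C,
          Polynomial.coeff_mul_X]
        have h1 := abs_le.1 (hterm a (hA a ha) _ (hPK (j + 1)))
        have h2 := abs_le.1 (hterm b (hB b hb) _ (hQK (j + 1)))
        have h3 := abs_le.1 (hPK j)
        have h5 := abs_le.1 (hQK j)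
        rw [abs_le]
        constructor <;> linarith
    · simp only [Polynomial.eval_mul, Polynomial.eval_C, Polynomial.eval_add, Polynomial.eval_sub,
        Polynomial.eval_X, hQA y hy]
      by_cases hya : y = a
      · rw [hya]; field_simp; ring
      · rw [hPA y (Finset.mem_erase.2 ⟨hya, hy⟩)]; field_simp; ring
    · simp only [Polynomial.eval_mul, Polynomial.eval_C, Polynomial.eval_add, Polynomial.eval_sub,
        Polynomial.eval_X, hPB y hy]
      by_cases hyb : y = b
      · rw [hyb]; ring
      · rw [hQB y (Finset.mem_erase.2 ⟨hyb, hy⟩)]; ring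

/-- The distribution functions of two distributions with altogether at most `n` atoms, and almost
equal moments of order less than `n`, almost agree at the points far from the atoms. -/
theorem abs_cdf_sub_cdf_le {k l n : ℕ} {w α : Fin k → ℝ} {v β : Fin l → ℝ} {δ γ t : ℝ}
    (hn : k + l ≤ n) (hα : ∀ i, α i ∈ Icc (0 : ℝ) 1) (hβ : ∀ j, β j ∈ Icc (0 : ℝ) 1)
    (hγ : 0 < γ) (hγ1 : γ ≤ 1) (htα : ∀ i, γ / 2 ≤ |t - α i|) (htβ : ∀ j, γ / 2 ≤ |t - β j|)
    (hδ : ∀ i < n, |∑ j, w j * α j ^ i - ∑ j, v j * β j ^ i| ≤ δ) :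
    |∑ i, w i * (if α i ≤ t then 1 else 0) - ∑ j, v j * (if β j ≤ t then 1 else 0)| ≤
      n * ((4 / γ) ^ n * δ) := by
  classical
  set S := Finset.univ.image α ∪ Finset.univ.image β with hS
  have hSc : S.card ≤ n := by
    refine (Finset.card_union_le _ _).trans ((Nat.add_le_add Finset.card_image_le
      Finset.card_image_le).trans ?_)
    simpa using hn
  have hS1 : ∀ y ∈ S, y ∈ Icc (0 : ℝ) 1 ∧ γ / 2 ≤ |t - y| := fun y hy => by
    simp only [hS, Finset.mem_union, Finset.mem_image, Finset.mem_univ, true_and] at hy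
    rcases hy with ⟨i, rfl⟩ | ⟨j, rfl⟩
    exacts [⟨hα i, htα i⟩, ⟨hβ j, htβ j⟩]
  -- Every atom is at least `γ / 2` away from `t`, so those on the left and those on the right are
  -- `γ` apart. On the atoms `P` is the step function, and the difference of the distribution
  -- functions becomes a combination of moment differences with the coefficients of `P`.
  obtain ⟨P, hP0, hPK, hPA, hPB⟩ := exists_step_polynomial hγ hγ1 n (S.filter (· ≤ t))
    (S.filter (¬ · ≤ t)) (by rwa [Finset.card_filter_add_card_filter_not])
    (fun y hy => (hS1 y (Finset.mem_of_mem_filter y hy)).1)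
    (fun y hy => (hS1 y (Finset.mem_of_mem_filter y hy)).1)
    fun a ha b hb => by
      rw [Finset.mem_filter] at ha hb
      have h1 := (hS1 a ha.1).2
      have h2 := (hS1 b hb.1).2
      rw [abs_of_nonneg (by linarith)] at h1
      rw [abs_of_neg (by linarith)] at h2
      linarith
  have hdeg : P.natDegree < n + 1 := by
    refine Nat.lt_succ_of_le (Polynomial.natDegree_le_iff_coeff_eq_zero.2 fun i hi => ?_)
    exact hP0 i (by omega)
  have heval : ∀ y ∈ S, (if y ≤ t then (1 : ℝ) else 0) =
      ∑ i ∈ Finset.range n, P.coeff i * y ^ i := fun y hy => by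
    have : P.eval y = ∑ i ∈ Finset.range n, P.coeff i * y ^ i := by
      rw [Polynomial.eval_eq_sum_range' hdeg, Finset.sum_range_succ, hP0 n le_rfl]
      simp
    rw [← this]
    split_ifs with h
    · exact (hPA y (Finset.mem_filter.2 ⟨hy, h⟩)).symm
    · exact (hPB y (Finset.mem_filter.2 ⟨hy, h⟩)).symm
  have hswap : ∀ {m : ℕ} (u η : Fin m → ℝ), (∀ j, η j ∈ S) →
      ∑ j, u j * (if η j ≤ t then 1 else 0) =
        ∑ i ∈ Finset.range n, P.coeff i * ∑ j, u j * η j ^ i := fun u η h => by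
    simp_rw [heval _ (h _), Finset.mul_sum]
    rw [Finset.sum_comm]
    exact Finset.sum_congr rfl fun i _ => Finset.sum_congr rfl fun j _ => by ring
  rw [hswap w α fun i => by simp [hS], hswap v β fun j => by simp [hS], ← Finset.sum_sub_distrib]
  refine (Finset.abs_sum_le_sum_abs _ _).trans ?_
  refine (Finset.sum_le_card_nsmul _ _ ((4 / γ) ^ n * δ) fun i hi => ?_).trans (by simp)
  rw [← mul_sub, abs_mul]
  exact mul_le_mul (hPK i) (hδ i (Finset.mem_range.1 hi)) (abs_nonneg _) (by positivity)

/-! ### The transportation distance and distribution functions -/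

/-- Telescoping with a cut-off; it evaluates the mass of the quantile coupling on initial blocks. -/
theorem sum_ite_lt_sub {k r : ℕ} (hr : r ≤ k) (h : ℕ → ℝ) :
    ∑ i : Fin k, (if (i : ℕ) < r then h (i + 1) - h i else 0) = h r - h 0 := by
  rw [Fin.sum_univ_eq_sum_range (fun i => if i < r then h (i + 1) - h i else 0) k,
    ← Finset.sum_range_sub, ← Finset.sum_filter]
  congr 1
  ext i
  simp only [Finset.mem_filter, Finset.mem_range]
  omega

/-- Sublevel sets of a monotone sequence are initial segments. -/
theorem exists_le_iff_lt {k : ℕ} {α : Fin k → ℝ} (hα : Monotone α) (t : ℝ) :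
    ∃ r ≤ k, ∀ i : Fin k, α i ≤ t ↔ (i : ℕ) < r := by
  by_cases h : ∃ r, ∃ hr : r < k, ¬ α ⟨r, hr⟩ ≤ t
  · classical
    obtain ⟨hr, hrt⟩ := Nat.find_spec h
    refine ⟨Nat.find h, hr.le, fun i => ⟨fun hi => ?_, fun hi => ?_⟩⟩
    · by_contra hlt
      exact hrt ((hα (show (⟨Nat.find h, hr⟩ : Fin k) ≤ i from not_lt.1 hlt)).trans hi)
    · by_contra hlt
      exact Nat.find_min h hi ⟨i.2, hlt⟩
  · push Not at h
    exact ⟨k, le_rfl, fun i => ⟨fun _ => i.2, fun _ => h i i.2⟩⟩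

/-- The sum of the first `r` entries. -/
noncomputable def partialSum {m : ℕ} (u : Fin m → ℝ) (r : ℕ) : ℝ :=
  ∑ i : Fin m, if (i : ℕ) < r then u i else 0

theorem partialSum_succ {m : ℕ} (u : Fin m → ℝ) (i : Fin m) :
    partialSum u (i + 1) = partialSum u i + u i := by
  have : u i = ∑ j, if j = i then u j else 0 := by simp
  simp only [partialSum]
  conv_rhs => rw [this]
  rw [← Finset.sum_add_distrib]
  refine Finset.sum_congr rfl fun j _ => ?_
  rcases lt_trichotomy j i with h | h | h
  · have h' : (j : ℕ) < i := h
    simp [h', h.ne, Nat.lt_succ_of_lt h']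
  · simp [h]
  · have h' : (i : ℕ) < j := h
    have h1 : ¬ (j : ℕ) < i := by omega
    have h2 : ¬ (j : ℕ) < i + 1 := by omega
    rw [if_neg h1, if_neg h2, if_neg h.ne', add_zero]

/-- The mass that the quantile coupling of `w` and `v` puts on the pair `(i, j)`. -/
noncomputable def quantileMass {k l : ℕ} (w : Fin k → ℝ) (v : Fin l → ℝ) (i j : ℕ) : ℝ :=
  (min (partialSum w (i + 1)) (partialSum v (j + 1)) -
      min (partialSum w i) (partialSum v (j + 1))) -
    (min (partialSum w (i + 1)) (partialSum v j) - min (partialSum w i) (partialSum v j))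

/-- The quantile coupling of two distributions on the line, for increasing spikes. -/
theorem exists_coupling_of_monotone {k l : ℕ} {w α : Fin k → ℝ} {v β : Fin l → ℝ}
    (hw : ∀ i, 0 ≤ w i) (hv : ∀ j, 0 ≤ v j) (hwv : ∑ i, w i = ∑ j, v j) (hα : Monotone α)
    (hβ : Monotone β) :
    ∃ x : Fin k → Fin l → ℝ, (∀ i j, 0 ≤ x i j) ∧ (∀ i, ∑ j, x i j = w i) ∧
      (∀ j, ∑ i, x i j = v j) ∧
      ∀ t, ∑ i, ∑ j, x i j * |(if α i ≤ t then 1 else 0) - (if β j ≤ t then 1 else 0)| =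
        |∑ i, w i * (if α i ≤ t then 1 else 0) - ∑ j, v j * (if β j ≤ t then 1 else 0)| := by
  set W := partialSum w with hW
  set V := partialSum v with hV
  have hW0 : W 0 = 0 := by simp [hW, partialSum]
  have hV0 : V 0 = 0 := by simp [hV, partialSum]
  have hWk : W k = ∑ i, w i := by simp [hW, partialSum]
  have hVl : V l = ∑ j, v j := by simp [hV, partialSum]
  have hWn : ∀ r, 0 ≤ W r := fun r => Finset.sum_nonneg fun i _ => by split_ifs <;> simp [hw i]
  have hVn : ∀ r, 0 ≤ V r := fun r => Finset.sum_nonneg fun i _ => by split_ifs <;> simp [hv i]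
  have hWle : ∀ r, W r ≤ ∑ i, w i := fun r =>
    Finset.sum_le_sum fun i _ => by split_ifs <;> simp [hw i]
  have hVle : ∀ r, V r ≤ ∑ j, v j := fun r =>
    Finset.sum_le_sum fun i _ => by split_ifs <;> simp [hv i]
  have hrow : ∀ (i : Fin k) (s : ℕ), s ≤ l →
      ∑ j : Fin l, (if (j : ℕ) < s then quantileMass w v i j else 0) =
        min (W (i + 1)) (V s) - min (W i) (V s) := fun i s hs => by
    refine (sum_ite_lt_sub hs fun j => min (W (i + 1)) (V j) - min (W i) (V j)).trans ?_
    rw [hV0, min_eq_right (hWn _), min_eq_right (hWn _)]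
    ring
  have hcol : ∀ (j : Fin l) (r : ℕ), r ≤ k →
      ∑ i : Fin k, (if (i : ℕ) < r then quantileMass w v i j else 0) =
        min (W r) (V (j + 1)) - min (W r) (V j) := fun j r hr => by
    have := sum_ite_lt_sub hr fun i => min (W i) (V (j + 1)) - min (W i) (V j)
    rw [hW0, min_eq_left (hVn _), min_eq_left (hVn _), sub_self, sub_zero] at this
    rw [← this]
    exact Finset.sum_congr rfl fun i _ => by
      simp only [quantileMass]
      split_ifs <;> ring
  have hxw : ∀ i : Fin k, ∑ j : Fin l, quantileMass w v i j = w i := fun i => by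
    have := hrow i l le_rfl
    simp only [Fin.is_lt, if_true] at this
    rw [this, hVl, ← hwv, min_eq_left (hWle _), min_eq_left (hWle _), hW, partialSum_succ]
    ring
  have hxv : ∀ j : Fin l, ∑ i : Fin k, quantileMass w v i j = v j := fun j => by
    have := hcol j k le_rfl
    simp only [Fin.is_lt, if_true] at this
    rw [this, hWk, hwv, min_eq_right (hVle _), min_eq_right (hVle _), hV, partialSum_succ]
    ring
  refine ⟨fun i j => quantileMass w v i j, fun i j => ?_, hxw, hxv, fun t => ?_⟩
  -- The mass is the length of the overlap of the intervals from `W i` to `W (i + 1)` and from `V j`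
  -- to `V (j + 1)`.
  · have h3 := hw i
    have h4 := hv j
    simp only [quantileMass, partialSum_succ, min_def]
    split_ifs <;> linarith
  · obtain ⟨r, hr, hrt⟩ := exists_le_iff_lt hα t
    obtain ⟨s, hs, hst⟩ := exists_le_iff_lt hβ t
    simp only [hrt, hst]
    have hWr : ∑ i, w i * (if (i : ℕ) < r then 1 else 0) = W r := by simp [hW, partialSum]
    have hVs : ∑ j, v j * (if (j : ℕ) < s then 1 else 0) = V s := by simp [hV, partialSum]
    rw [hWr, hVs]
    -- For indicators `|a - b| = a + b - 2 * a * b`. The product term sums to the mass of the block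
    -- `i < r`, `j < s`, which is `min (W r) (V s)`.
    have key : ∀ (y : ℝ) (i : Fin k) (j : Fin l),
        y * |(if (i : ℕ) < r then (1 : ℝ) else 0) - (if (j : ℕ) < s then 1 else 0)| =
          y * (if (i : ℕ) < r then 1 else 0) + y * (if (j : ℕ) < s then 1 else 0) -
          2 * ((if (j : ℕ) < s then y else 0) * (if (i : ℕ) < r then 1 else 0)) :=
      fun y i j => by (split_ifs <;> norm_num); ring
    calc _ = W r + V s - 2 * min (W r) (V s) := by
          simp_rw [key, Finset.sum_sub_distrib, Finset.sum_add_distrib]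
          congr 1
          · congr 1
            · simp_rw [← Finset.sum_mul, hxw]
              exact hWr
            · rw [Finset.sum_comm]
              simp_rw [← Finset.sum_mul, hxv]
              exact hVs
          · simp_rw [← Finset.mul_sum, ← Finset.sum_mul, hrow _ s hs]
            congr 1
            have := sum_ite_lt_sub hr fun i => min (W i) (V s)
            rw [hW0, min_eq_left (hVn _), sub_zero] at this
            rw [← this]
            exact Finset.sum_congr rfl fun i _ => by split_ifs <;> simp
      _ = |W r - V s| := by
        rcases le_total (W r) (V s) with h | h
        · rw [min_eq_left h, abs_of_nonpos (by linarith)]; ring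
        · rw [min_eq_right h, abs_of_nonneg (by linarith)]; ring

/-- The quantile coupling of two distributions on the line. -/
theorem exists_coupling {k l : ℕ} {w : Fin k → ℝ} (α : Fin k → ℝ) {v : Fin l → ℝ} (β : Fin l → ℝ)
    (hw : ∀ i, 0 ≤ w i) (hv : ∀ j, 0 ≤ v j) (hwv : ∑ i, w i = ∑ j, v j) :
    ∃ x : Fin k → Fin l → ℝ, (∀ i j, 0 ≤ x i j) ∧ (∀ i, ∑ j, x i j = w i) ∧
      (∀ j, ∑ i, x i j = v j) ∧
      ∀ t, ∑ i, ∑ j, x i j * |(if α i ≤ t then 1 else 0) - (if β j ≤ t then 1 else 0)| =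
        |∑ i, w i * (if α i ≤ t then 1 else 0) - ∑ j, v j * (if β j ≤ t then 1 else 0)| := by
  set p := Tuple.sort α
  set q := Tuple.sort β
  obtain ⟨x, hx, hxw, hxv, hxt⟩ := exists_coupling_of_monotone (w := w ∘ p) (v := v ∘ q)
    (α := α ∘ p) (β := β ∘ q)
    (fun i => hw _) (fun j => hv _)
    (by simpa [Equiv.sum_comp p w, Equiv.sum_comp q v] using hwv)
    (Tuple.monotone_sort α) (Tuple.monotone_sort β)
  refine ⟨fun i j => x (p.symm i) (q.symm j), fun i j => hx _ _, fun i => ?_, fun j => ?_,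
    fun t => ?_⟩
  · rw [Equiv.sum_comp q.symm fun j => x (p.symm i) j, hxw]
    simp
  · rw [Equiv.sum_comp p.symm fun i => x i (q.symm j), hxv]
    simp
  · have h := hxt t
    simp only [Function.comp_apply] at h
    rw [Equiv.sum_comp p fun i => w i * (if α i ≤ t then (1 : ℝ) else 0),
      Equiv.sum_comp q fun j => v j * (if β j ≤ t then (1 : ℝ) else 0)] at h
    rw [← h, ← Equiv.sum_comp p]
    refine Finset.sum_congr rfl fun i _ => ?_
    rw [← Equiv.sum_comp q]
    simp

theorem transportDist_le_of_coupling {k l : ℕ} {w α : Fin k → ℝ} {v β : Fin l → ℝ}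
    {x : Fin k → Fin l → ℝ} (hx : ∀ i j, 0 ≤ x i j) (hw : ∀ i, ∑ j, x i j = w i)
    (hv : ∀ j, ∑ i, x i j = v j) :
    transportDist w α v β ≤ ∑ i, ∑ j, x i j * |α i - β j| := by
  refine csInf_le ⟨0, ?_⟩ ⟨x, hx, hw, hv, rfl⟩
  rintro c ⟨y, hy, -, -, rfl⟩
  exact Finset.sum_nonneg fun i _ => Finset.sum_nonneg fun j _ => mul_nonneg (hy i j) (abs_nonneg _)

/-- The two step functions differ exactly between `a` and `b`. This turns the cost of a coupling
into an integral over `t`. -/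
theorem abs_sub_eq_integral {a b : ℝ} (ha : a ∈ Icc (0 : ℝ) 1) (hb : b ∈ Icc (0 : ℝ) 1) :
    |a - b| =
      ∫ t in Icc (0 : ℝ) 1, |(if a ≤ t then 1 else 0) - (if b ≤ t then (1 : ℝ) else 0)| := by
  have h : ∀ t, |(if a ≤ t then 1 else 0) - (if b ≤ t then (1 : ℝ) else 0)| =
      (Ico (min a b) (max a b)).indicator (fun _ => (1 : ℝ)) t := fun t => by
    rcases le_total a b with h | h
    · simp only [min_eq_left h, max_eq_right h, indicator, mem_Ico]
      split_ifs <;> first | (norm_num; done) | (exfalso; grind)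
    · simp only [min_eq_right h, max_eq_left h, indicator, mem_Ico]
      split_ifs <;> first | (norm_num; done) | (exfalso; grind)
  simp_rw [h]
  rw [integral_indicator_const _ measurableSet_Ico, measureReal_restrict_apply measurableSet_Ico,
    inter_eq_left.2, Real.volume_real_Ico_of_le min_le_max, max_sub_min_eq_abs']
  · simp
  · exact fun t ht => ⟨(le_min ha.1 hb.1).trans ht.1, ht.2.le.trans (max_le ha.2 hb.2)⟩

/-- The transportation distance is at most the integral of the difference of the distribution
functions, which is assumed to be at most `D` except in the vicinity of the spikes. -/
theorem transportDist_le_of_cdf {k l : ℕ} {w α : Fin k → ℝ} {v β : Fin l → ℝ}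
    (hw : w ∈ stdSimplex ℝ (Fin k)) (hv : v ∈ stdSimplex ℝ (Fin l))
    (hα : ∀ i, α i ∈ Icc (0 : ℝ) 1) (hβ : ∀ j, β j ∈ Icc (0 : ℝ) 1) {D γ : ℝ} (hD : 0 ≤ D)
    (hγ : 0 ≤ γ) (h : ∀ t, (∀ i, γ / 2 ≤ |t - α i|) → (∀ j, γ / 2 ≤ |t - β j|) →
      |∑ i, w i * (if α i ≤ t then 1 else 0) - ∑ j, v j * (if β j ≤ t then 1 else 0)| ≤ D) :
    transportDist w α v β ≤ D + (k + l) * γ := by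
  obtain ⟨x, hx, hxw, hxv, hxt⟩ := exists_coupling α β hw.1 hv.1 (hw.2.trans hv.2.symm)
  refine (transportDist_le_of_coupling hx hxw hxv).trans ?_
  set μ : Measure ℝ := volume.restrict (Icc (0 : ℝ) 1) with hμ
  have hμ1 : μ.real univ = 1 := by simp [hμ]
  have hcdf : ∀ {m : ℕ} {u : Fin m → ℝ} (η : Fin m → ℝ) (t : ℝ), u ∈ stdSimplex ℝ (Fin m) →
      ∑ i, u i * (if η i ≤ t then 1 else 0) ∈ Icc (0 : ℝ) 1 := fun {m u} η t hu => by
    refine ⟨Finset.sum_nonneg fun i _ => mul_nonneg (hu.1 i) (by split_ifs <;> norm_num), ?_⟩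
    exact (Finset.sum_le_sum fun i _ => mul_le_of_le_one_right (hu.1 i)
      (by split_ifs <;> norm_num)).trans hu.2.le
  -- Near an atom the trivial bound `1` on the difference of distribution functions is used; each
  -- such window has length `γ`.
  set near : ℝ → ℝ → ℝ := fun y => (Ioo (y - γ / 2) (y + γ / 2)).indicator fun _ => (1 : ℝ)
    with hnear
  have hnear0 : ∀ y t, 0 ≤ near y t := fun y t => indicator_nonneg (fun _ _ => zero_le_one) t
  have hnear1 : ∀ y t, ¬ γ / 2 ≤ |t - y| → near y t = 1 := fun y t ht => by
    rw [not_le, abs_lt] at ht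
    exact indicator_of_mem (show t ∈ Ioo _ _ from ⟨by linarith, by linarith⟩) _
  have hneari : ∀ y, Integrable (near y) μ := fun y =>
    (integrable_const (1 : ℝ)).indicator measurableSet_Ioo
  have hnearI : ∀ y, ∫ t, near y t ∂μ ≤ γ := fun y => by
    rw [hnear, integral_indicator_const _ measurableSet_Ioo]
    have h1 : μ.real (Ioo (y - γ / 2) (y + γ / 2)) ≤ volume.real (Ioo (y - γ / 2) (y + γ / 2)) :=
      ENNReal.toReal_mono (by simp) (Measure.restrict_apply_le _ _)
    rw [Real.volume_real_Ioo_of_le (by linarith)] at h1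
    simpa using h1.trans (by linarith)
  have hpt : ∀ t, ∑ i, ∑ j, x i j * |(if α i ≤ t then 1 else 0) - (if β j ≤ t then 1 else 0)| ≤
      D + (∑ i, near (α i) t + ∑ j, near (β j) t) := fun t => by
    rw [hxt t]
    have h1 := hcdf α t hw
    have h2 := hcdf β t hv
    have h3 : 0 ≤ ∑ i, near (α i) t := Finset.sum_nonneg fun i _ => hnear0 _ _
    have h4 : 0 ≤ ∑ j, near (β j) t := Finset.sum_nonneg fun j _ => hnear0 _ _
    have h5 : |∑ i, w i * (if α i ≤ t then 1 else 0) - ∑ j, v j * (if β j ≤ t then 1 else 0)| ≤ 1 :=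
      abs_le.2 ⟨by linarith [h1.1, h2.2], by linarith [h1.2, h2.1]⟩
    by_cases hfar : (∀ i, γ / 2 ≤ |t - α i|) ∧ ∀ j, γ / 2 ≤ |t - β j|
    · linarith [h t hfar.1 hfar.2]
    · rw [not_and_or, not_forall, not_forall] at hfar
      rcases hfar with ⟨i, hi⟩ | ⟨j, hj⟩
      · have := Finset.single_le_sum (f := fun i => near (α i) t) (fun i _ => hnear0 _ _)
          (Finset.mem_univ i)
        simp only [hnear1 _ _ hi] at this
        linarith
      · have := Finset.single_le_sum (f := fun j => near (β j) t) (fun i _ => hnear0 _ _)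
          (Finset.mem_univ j)
        simp only [hnear1 _ _ hj] at this
        linarith
  have hmeas : ∀ i j, Integrable (fun t => x i j *
      |(if α i ≤ t then 1 else 0) - (if β j ≤ t then (1 : ℝ) else 0)|) μ := fun i j => by
    have hs : ∀ y : ℝ, Integrable (fun t : ℝ => if y ≤ t then (1 : ℝ) else 0) μ := fun y =>
      ((integrable_const (1 : ℝ)).indicator (measurableSet_Ici (a := y))).congr
        (Filter.Eventually.of_forall fun t => by simp [indicator])
    exact (((hs _).sub (hs _)).abs).const_mul _
  calc ∑ i, ∑ j, x i j * |α i - β j|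
      = ∫ t, ∑ i, ∑ j, x i j * |(if α i ≤ t then 1 else 0) - (if β j ≤ t then 1 else 0)| ∂μ := by
        rw [integral_finsetSum _ fun i _ => integrable_finsetSum _ fun j _ => hmeas i j]
        refine Finset.sum_congr rfl fun i _ => ?_
        rw [integral_finsetSum _ fun j _ => hmeas i j]
        refine Finset.sum_congr rfl fun j _ => ?_
        rw [integral_const_mul, ← abs_sub_eq_integral (hα i) (hβ j)]
    _ ≤ ∫ t, (D + (∑ i, near (α i) t + ∑ j, near (β j) t)) ∂μ :=
        integral_mono
          (integrable_finsetSum _ fun i _ => integrable_finsetSum _ fun j _ => hmeas i j)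
          ((integrable_const _).add ((integrable_finsetSum _ fun i _ => hneari _).add
            (integrable_finsetSum _ fun j _ => hneari _))) hpt
    _ = D + (∑ i, ∫ t, near (α i) t ∂μ + ∑ j, ∫ t, near (β j) t ∂μ) := by
        have h1 : Integrable (fun t => ∑ i, near (α i) t) μ :=
          integrable_finsetSum _ fun i _ => hneari _
        have h2 : Integrable (fun t => ∑ j, near (β j) t) μ :=
          integrable_finsetSum _ fun j _ => hneari _
        have h3 : Integrable (fun t => ∑ i, near (α i) t + ∑ j, near (β j) t) μ := h1.add h2
        rw [integral_add (integrable_const _) h3, integral_add h1 h2,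
          integral_finsetSum _ fun i _ => hneari _, integral_finsetSum _ fun i _ => hneari _,
          integral_const, hμ1, one_smul]
    _ ≤ D + (k * γ + l * γ) := by
        gcongr
        · exact (Finset.sum_le_card_nsmul _ _ _ fun i _ => hnearI (α i)).trans (by simp)
        · exact (Finset.sum_le_card_nsmul _ _ _ fun j _ => hnearI (β j)).trans (by simp)
    _ = D + (k + l) * γ := by ring

theorem transportDist_le_one {k l : ℕ} {w α : Fin k → ℝ} {v β : Fin l → ℝ}
    (hw : w ∈ stdSimplex ℝ (Fin k)) (hv : v ∈ stdSimplex ℝ (Fin l))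
    (hα : ∀ i, α i ∈ Icc (0 : ℝ) 1) (hβ : ∀ j, β j ∈ Icc (0 : ℝ) 1) :
    transportDist w α v β ≤ 1 := by
  refine (transportDist_le_of_coupling (x := fun i j => w i * v j)
    (fun i j => mul_nonneg (hw.1 i) (hv.1 j)) (fun i => by rw [← Finset.mul_sum, hv.2, mul_one])
    fun j => by rw [← Finset.sum_mul, hw.2, one_mul]).trans ?_
  calc ∑ i, ∑ j, w i * v j * |α i - β j| ≤ ∑ i, ∑ j, w i * v j :=
        Finset.sum_le_sum fun i _ => Finset.sum_le_sum fun j _ =>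
          mul_le_of_le_one_right (mul_nonneg (hw.1 i) (hv.1 j))
            (abs_sub_le_of_nonneg_of_le (hα i).1 (hα i).2 (hβ j).1 (hβ j).2)
    _ = 1 := by simp_rw [← Finset.mul_sum, hv.2, mul_one, hw.2]

/-! ### Concentration of the empirical moments -/

/-- One-sided Hoeffding inequality for independent samples. -/
theorem measureReal_pi_le_sum_sub_le {Ω : Type*} [MeasurableSpace Ω] (μ : Measure Ω)
    [IsProbabilityMeasure μ] {f : Ω → ℝ} (hf : Measurable f) (hf1 : ∀ ω, f ω ∈ Icc (0 : ℝ) 1)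
    (N : ℕ) {ε : ℝ} (hε : 0 ≤ ε) :
    (Measure.pi fun _ : Fin N => μ).real {z | N * ε ≤ ∑ n, f (z n) - N * ∫ ω, f ω ∂μ} ≤
      Real.exp (-(2 * N * ε ^ 2)) := by
  have hind : ProbabilityTheory.iIndepFun
      (fun (n : Fin N) (z : Fin N → Ω) => f (z n) - ∫ ω, f ω ∂μ) (Measure.pi fun _ => μ) :=
    ProbabilityTheory.iIndepFun_pi (Ω := fun _ => Ω) (X := fun _ ω => f ω - ∫ ω, f ω ∂μ) fun _ =>
      (hf.sub_const _).aemeasurable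
  have hsub := ProbabilityTheory.hasSubgaussianMGF_of_mem_Icc (μ := μ) hf.aemeasurable
    (Filter.Eventually.of_forall hf1)
  have hsub' : ∀ n ∈ (Finset.univ : Finset (Fin N)), ProbabilityTheory.HasSubgaussianMGF
      (fun z : Fin N → Ω => f (z n) - ∫ ω, f ω ∂μ) ((‖(1 : ℝ) - 0‖₊ / 2) ^ 2)
      (Measure.pi fun _ : Fin N => μ) := fun n _ => by
    have hmap := (measurePreserving_eval (fun _ : Fin N => μ) n).map_eq
    refine ProbabilityTheory.HasSubgaussianMGF.of_map (Y := fun z : Fin N → Ω => z n)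
      (X := fun ω : Ω => f ω - ∫ ω, f ω ∂μ) (measurable_pi_apply n).aemeasurable ?_
    rw [show (Measure.pi fun _ : Fin N => μ).map (fun z => z n) = μ from hmap]
    exact hsub
  have h := ProbabilityTheory.HasSubgaussianMGF.measure_sum_ge_le_of_iIndepFun hind hsub'
    (ε := N * ε) (by positivity)
  have hset : {z : Fin N → Ω | N * ε ≤ ∑ n, f (z n) - N * ∫ ω, f ω ∂μ} =
      {z | N * ε ≤ ∑ n, (f (z n) - ∫ ω, f ω ∂μ)} := by
    ext z
    simp
  rw [hset]
  refine h.trans (Real.exp_le_exp.2 (le_of_eq ?_))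
  simp only [sub_zero, nnnorm_one, Finset.sum_const, Finset.card_univ, Fintype.card_fin,
    nsmul_eq_mul, NNReal.coe_mul, NNReal.coe_natCast, NNReal.coe_pow, NNReal.coe_div,
    NNReal.coe_one, NNReal.coe_ofNat]
  rcases N.eq_zero_or_pos with rfl | hN
  · simp
  · have : (N : ℝ) ≠ 0 := by positivity
    field_simp

/-- Hoeffding inequality for independent samples. -/
theorem measureReal_pi_lt_abs_sum_sub_le {Ω : Type*} [MeasurableSpace Ω] (μ : Measure Ω)
    [IsProbabilityMeasure μ] {f : Ω → ℝ} (hf : Measurable f) (hf1 : ∀ ω, f ω ∈ Icc (0 : ℝ) 1)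
    (N : ℕ) {ε : ℝ} (hε : 0 ≤ ε) :
    (Measure.pi fun _ : Fin N => μ).real {z | N * ε < |∑ n, f (z n) - N * ∫ ω, f ω ∂μ|} ≤
      2 * Real.exp (-(2 * N * ε ^ 2)) := by
  have hint : Integrable f μ := Integrable.of_mem_Icc 0 1 hf.aemeasurable
    (Filter.Eventually.of_forall hf1)
  have h1 := measureReal_pi_le_sum_sub_le μ hf hf1 N hε
  have h2 := measureReal_pi_le_sum_sub_le μ (f := fun ω => 1 - f ω) (hf.const_sub 1)
    (fun ω => ⟨by linarith [(hf1 ω).2], by linarith [(hf1 ω).1]⟩) N hε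
  rw [integral_sub (integrable_const _) hint] at h2
  simp only [Finset.sum_sub_distrib, integral_const, probReal_univ, smul_eq_mul, Finset.sum_const,
    Finset.card_univ, Fintype.card_fin, nsmul_eq_mul, mul_one] at h2
  rw [two_mul]
  refine le_trans ?_ (add_le_add h1 h2)
  refine le_trans (measureReal_mono ?_) (measureReal_union_le _ _)
  intro z hz
  rw [mem_ofPred_eq, lt_abs] at hz
  rcases hz with h | h
  · exact Or.inl h.le
  · refine Or.inr ?_
    rw [mem_ofPred_eq]
    linarith

/-- The product of the first `i` coordinates of a snapshot. -/
noncomputable def prefixProd {m : ℕ} (i : ℕ) (z : Fin m → unitInterval) : ℝ :=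
  ∏ l : Fin m, if (l : ℕ) < i then (z l : ℝ) else 1

theorem prefixProd_mem_Icc {m : ℕ} (i : ℕ) (z : Fin m → unitInterval) :
    prefixProd i z ∈ Icc (0 : ℝ) 1 := by
  have h : ∀ l : Fin m, 0 ≤ (if (l : ℕ) < i then (z l : ℝ) else 1) ∧
      (if (l : ℕ) < i then (z l : ℝ) else 1) ≤ 1 := fun l => by
    split_ifs
    · exact (z l).2
    · norm_num
  exact ⟨Finset.prod_nonneg fun l _ => (h l).1,
    Finset.prod_le_one (fun l _ => (h l).1) fun l _ => (h l).2⟩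

theorem measurable_prefixProd {m : ℕ} (i : ℕ) :
    Measurable (prefixProd i : (Fin m → unitInterval) → ℝ) := by
  unfold prefixProd
  refine Finset.measurable_prod _ fun l _ => ?_
  split_ifs
  · exact measurable_subtype_coe.comp (measurable_pi_apply l)
  · exact measurable_const

/-! ### Moments of the snapshot law -/

namespace MixtureSource

variable {k : ℕ} (θ : MixtureSource k)

theorem mean_mem_Icc (j : Fin k) : θ.mean j ∈ Icc (0 : ℝ) 1 := by
  refine ⟨integral_nonneg fun x => x.2.1, ?_⟩
  have h : θ.mean j ≤ ∫ _ : unitInterval, (1 : ℝ) ∂(θ.constituent j : Measure unitInterval) :=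
    integral_mono (Integrable.of_mem_Icc 0 1 measurable_subtype_coe.aemeasurable
      (Filter.Eventually.of_forall fun x => x.2)) (integrable_const _) fun x => x.2.2
  simpa using h

instance isProbabilityMeasure_snapshotLaw (m : ℕ) : IsProbabilityMeasure (θ.snapshotLaw m) := by
  refine ⟨?_⟩
  simp only [snapshotLaw, Measure.finsetSum_apply, Measure.smul_apply, measure_univ, smul_eq_mul,
    mul_one]
  rw [← ENNReal.ofReal_sum_of_nonneg fun j _ => θ.weight_mem.1 j, θ.weight_mem.2,
    ENNReal.ofReal_one]

/-- Products of distinct coordinates see only the means of the constituents, whereas powers of one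
coordinate would see their higher moments. Orders up to `2 * k - 1` require aperture `2 * k - 1`. -/
theorem integral_prefixProd {m i : ℕ} (hi : i ≤ m) :
    ∫ z, prefixProd i z ∂(θ.snapshotLaw m) = ∑ j, θ.weight j * θ.mean j ^ i := by
  have hint : ∀ (μ : Measure (Fin m → unitInterval)) [IsFiniteMeasure μ],
      Integrable (prefixProd i) μ := fun μ _ =>
    Integrable.of_mem_Icc 0 1 (measurable_prefixProd i).aemeasurable
      (Filter.Eventually.of_forall (prefixProd_mem_Icc i))
  rw [snapshotLaw, integral_finsetSum_measure fun j _ =>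
    (hint _).smul_measure ENNReal.ofReal_ne_top]
  refine Finset.sum_congr rfl fun j _ => ?_
  rw [integral_smul_measure, ENNReal.toReal_ofReal (θ.weight_mem.1 j), smul_eq_mul]
  congr 1
  unfold prefixProd
  rw [integral_fintype_prod_eq_prod (𝕜 := ℝ)
    (fun (l : Fin m) (y : unitInterval) => if (l : ℕ) < i then (y : ℝ) else 1)]
  have : ∀ l : Fin m, ∫ y : unitInterval, (if (l : ℕ) < i then (y : ℝ) else 1)
      ∂(θ.constituent j : Measure unitInterval) = if (l : ℕ) < i then θ.mean j else 1 := fun l => by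
    split_ifs
    · rfl
    · simp
  simp_rw [this]
  rw [Fin.prod_univ_eq_prod_range (fun l => if l < i then θ.mean j else 1) m,
    Finset.prod_ite, Finset.prod_const_one, mul_one, Finset.prod_const]
  congr 1
  rw [show (Finset.range m).filter (· < i) = Finset.range i by
    ext; simp only [Finset.mem_filter, Finset.mem_range]; omega, Finset.card_range]

/-- The event that the first `n` empirical moments deviate by at most `ε`. -/
def goodEvent (m N n : ℕ) (ε : ℝ) : Set (Fin N → Fin m → unitInterval) :=
  {z | ∀ i < n, |∑ a, prefixProd i (z a) - N * ∑ j, θ.weight j * θ.mean j ^ i| ≤ N * ε}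

theorem measurableSet_goodEvent (m N n : ℕ) (ε : ℝ) :
    MeasurableSet (θ.goodEvent m N n ε) := by
  simp only [goodEvent, ofPred_forall]
  refine MeasurableSet.iInter fun i => MeasurableSet.iInter fun _ =>
    measurableSet_le (Measurable.abs (Measurable.sub_const (Finset.measurable_sum _ fun a _ =>
      (measurable_prefixProd i).comp (measurable_pi_apply a)) _)) measurable_const

theorem ofReal_le_sampleLaw_goodEvent {m n : ℕ} (hn : n ≤ m + 1) (N : ℕ) {ε : ℝ} (hε : 0 ≤ ε) :
    ENNReal.ofReal (1 - n * (2 * Real.exp (-(2 * N * ε ^ 2)))) ≤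
      θ.sampleLaw m N (θ.goodEvent m N n ε) := by
  have hprob : IsProbabilityMeasure (θ.sampleLaw m N) := by
    unfold sampleLaw
    infer_instance
  rw [ENNReal.ofReal_le_iff_le_toReal (measure_ne_top _ _)]
  change _ ≤ (θ.sampleLaw m N).real (θ.goodEvent m N n ε)
  have hcompl : (θ.sampleLaw m N).real (θ.goodEvent m N n ε)ᶜ ≤
      n * (2 * Real.exp (-(2 * N * ε ^ 2))) := by
    have hsub : (θ.goodEvent m N n ε)ᶜ ⊆ ⋃ i ∈ Finset.range n, {z | N * ε <
        |∑ a, prefixProd i (z a) - N * ∫ z, prefixProd i z ∂(θ.snapshotLaw m)|} := by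
      intro z hz
      simp only [goodEvent, mem_compl_iff, mem_ofPred_eq, not_forall, not_le] at hz
      obtain ⟨i, hi, h⟩ := hz
      simp only [mem_iUnion, Finset.mem_range]
      refine ⟨i, hi, ?_⟩
      rwa [mem_ofPred_eq, θ.integral_prefixProd (by omega)]
    refine (measureReal_mono hsub (measure_ne_top _ _)).trans
      ((measureReal_biUnion_finset_le _ _).trans ?_)
    refine (Finset.sum_le_card_nsmul _ _ _ fun i _ => measureReal_pi_lt_abs_sum_sub_le
      (θ.snapshotLaw m) (measurable_prefixProd i) (prefixProd_mem_Icc i) N hε).trans ?_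
    simp
  rw [probReal_compl_eq_one_sub (θ.measurableSet_goodEvent m N n ε)] at hcompl
  linarith

end MixtureSource

/-! ### Correctness of the search -/

/-- Factors are exchanged one at a time, the others being at most one. -/
theorem abs_prod_sub_prod_le {n : ℕ} {a b : ℕ → ℝ} {η : ℝ} (ha : ∀ i < n, a i ∈ Icc (0 : ℝ) 1)
    (hb : ∀ i < n, b i ∈ Icc (0 : ℝ) 1) (hab : ∀ i < n, |a i - b i| ≤ η) :
    |∏ i ∈ Finset.range n, a i - ∏ i ∈ Finset.range n, b i| ≤ n * η := by
  induction n with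
  | zero => simp
  | succ n ih =>
    rw [Finset.prod_range_succ, Finset.prod_range_succ]
    set A := ∏ i ∈ Finset.range n, a i
    set B := ∏ i ∈ Finset.range n, b i
    have hB0 : 0 ≤ B := Finset.prod_nonneg fun i hi =>
      (hb i (by have := Finset.mem_range.1 hi; omega)).1
    have hB1 : B ≤ 1 := Finset.prod_le_one
      (fun i hi => (hb i (by have := Finset.mem_range.1 hi; omega)).1)
      fun i hi => (hb i (by have := Finset.mem_range.1 hi; omega)).2
    have h1 := ih (fun i hi => ha i (by omega)) (fun i hi => hb i (by omega))
      fun i hi => hab i (by omega)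
    have h2 := hab n (by omega)
    have h3 := ha n (by omega)
    calc |A * a n - B * b n| = |(A - B) * a n + B * (a n - b n)| := by ring_nf
      _ ≤ |A - B| * |a n| + |B| * |a n - b n| := by
        rw [← abs_mul, ← abs_mul]; exact abs_add_le _ _
      _ ≤ n * η * 1 + 1 * η := by
        rw [abs_of_nonneg h3.1, abs_of_nonneg hB0]
        gcongr
        · exact h3.1
        · exact (abs_nonneg _).trans h1
        · exact h3.2
      _ = (n + 1 : ℕ) * η := by push_cast; ring

theorem abs_pow_sub_pow_le_mul {a b η : ℝ} (ha : a ∈ Icc (0 : ℝ) 1) (hb : b ∈ Icc (0 : ℝ) 1)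
    (hab : |a - b| ≤ η) (n : ℕ) : |a ^ n - b ^ n| ≤ n * η := by
  simpa using abs_prod_sub_prod_le (n := n) (a := fun _ => a) (b := fun _ => b) (fun _ _ => ha)
    (fun _ _ => hb) fun _ _ => hab

namespace SpikeSearch

/-- The number is built with an extra leading digit `1` above the prescribed ones, which accounts
for the factor `2`. -/
theorem exists_digits {M : ℕ} (n : ℕ) : ∀ d : ℕ → ℕ, (∀ i < n, d i < M) →
    ∃ c, 0 < c ∧ c < 2 * M ^ n ∧ ∀ i < n, digit M c i = d i := by
  induction n with
  | zero => exact fun d _ => ⟨1, by simp⟩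
  | succ n ih =>
    intro d hd
    obtain ⟨c, hc, hcM, h⟩ := ih (fun i => d (i + 1)) fun i hi => hd (i + 1) (by omega)
    have h0 := hd 0 (by omega)
    have hM : 0 < M := by omega
    refine ⟨d 0 + M * c, by positivity, ?_, fun i hi => ?_⟩
    · have := Nat.mul_le_mul_left M (Nat.succ_le_of_lt hcM)
      rw [Nat.mul_succ] at this
      calc d 0 + M * c < M * (2 * M ^ n) := by omega
        _ = 2 * M ^ (n + 1) := by ring
    · cases i with
      | zero => simp [digit, Nat.mod_eq_of_lt h0]
      | succ i =>
        rw [← h i (by omega), digit, digit, pow_succ', ← Nat.div_div_eq_div_mul,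
          Nat.add_mul_div_left _ _ hM, Nat.div_eq_of_lt h0, zero_add]

/-- Rounding a distribution to a candidate. -/
theorem exists_candidate {k M : ℕ} (hkM : k ≤ M) (hk : 0 < k) {w α : Fin k → ℝ}
    (hw : w ∈ stdSimplex ℝ (Fin k)) (hα : ∀ j, α j ∈ Icc (0 : ℝ) 1) :
    ∃ c, 0 < c ∧ c < 2 * M ^ (2 * k) ∧ ∑ j ∈ Finset.range k, weight M c j = M ∧
      (∀ j : Fin k, |(weight M c j : ℝ) - M * w j| ≤ 2 * k) ∧
      ∀ j : Fin k, |(location k M c j : ℝ) - k * M * α j| ≤ k := by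
  have hM : 0 < M := hk.trans_le hkM
  -- Rounding partial sums instead of single weights keeps the total exact: the differences
  -- telescope to `M - k`, and the increments by one in `weight` supply the remaining `k`.
  set f : ℕ → ℕ := fun j => ⌊((M - k : ℕ) : ℝ) * partialSum w j⌋₊ with hf
  have hmono : Monotone (partialSum w) := fun r s hrs => Finset.sum_le_sum fun i _ => by
    have := hw.1 i
    split_ifs <;> linarith
  have hf0 : f 0 = 0 := by simp [hf, partialSum]
  have hfk : f k = M - k := by
    have : partialSum w k = 1 := by simpa [partialSum] using hw.2
    simp only [hf, this, mul_one, Nat.floor_natCast]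
  have hfmono : Monotone f := fun r s hrs =>
    Nat.floor_mono (mul_le_mul_of_nonneg_left (hmono hrs) (Nat.cast_nonneg _))
  -- The cap `M - 1` matters only for a location equal to `1`, whose floor would not be a digit.
  set d : ℕ → ℕ := fun i => if i < k then f (i + 1) - f i else
    if h : i - k < k then min ⌊α ⟨i - k, h⟩ * M⌋₊ (M - 1) else 0 with hd
  have hdlt : ∀ i, d i < M := fun i => by
    simp only [hd]
    split_ifs with h1 h2
    · have := hfmono (show i + 1 ≤ k by omega)
      omega
    · exact (min_le_right _ _).trans_lt (by omega)
    · exact hM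
  obtain ⟨c, hc0, hcM, hc⟩ := exists_digits (2 * k) d fun i _ => hdlt i
  have hwt : ∀ j < k, weight M c j = f (j + 1) - f j + 1 := fun j hj => by
    rw [weight, hc j (by omega), hd]
    simp [hj]
  refine ⟨c, hc0, hcM, ?_, fun j => ?_, fun j => ?_⟩
  · rw [Finset.sum_congr rfl fun j hj => hwt j (Finset.mem_range.1 hj), Finset.sum_add_distrib,
      Finset.sum_range_tsub hfmono, hf0, hfk]
    simp only [Finset.sum_const, Finset.card_range, smul_eq_mul]
    omega
  · rw [hwt j j.2, Nat.cast_add, Nat.cast_sub (hfmono (Nat.le_succ _)), Nat.cast_one]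
    have hk1 : (1 : ℝ) ≤ k := by exact_mod_cast hk
    have hnn : ∀ r, 0 ≤ ((M - k : ℕ) : ℝ) * partialSum w r := fun r =>
      mul_nonneg (Nat.cast_nonneg _) (by
        have := hmono (Nat.zero_le r)
        simpa [partialSum] using this)
    have h1 := Nat.floor_le (hnn j)
    have h2 := Nat.lt_floor_add_one (((M - k : ℕ) : ℝ) * partialSum w j)
    have h3 := Nat.floor_le (hnn (j + 1))
    have h4 := Nat.lt_floor_add_one (((M - k : ℕ) : ℝ) * partialSum w (j + 1))
    change (f j : ℝ) ≤ _ at h1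
    change _ < (f j : ℝ) + 1 at h2
    change (f (j + 1) : ℝ) ≤ _ at h3
    change _ < (f (j + 1) : ℝ) + 1 at h4
    rw [partialSum_succ, mul_add] at h3 h4
    rw [Nat.cast_sub hkM] at h1 h2 h3 h4
    have h5 : 0 ≤ (k : ℝ) * w j := mul_nonneg (Nat.cast_nonneg _) (hw.1 j)
    have h6 : (k : ℝ) * w j ≤ k := mul_le_of_le_one_right (Nat.cast_nonneg _)
      ((Finset.single_le_sum (fun i _ => hw.1 i) (Finset.mem_univ j)).trans hw.2.le)
    rw [abs_le]
    constructor <;> nlinarith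
  · have hj := j.2
    have hloc : location k M c j = k * min ⌊α j * M⌋₊ (M - 1) + j := by
      rw [location, hc (k + j) (by omega), hd]
      simp [hj]
    have hM0 : (0 : ℝ) < M := by exact_mod_cast hM
    have hαM : 0 ≤ α j * M := mul_nonneg (hα j).1 hM0.le
    have h1 : ((min ⌊α j * M⌋₊ (M - 1) : ℕ) : ℝ) ≤ α j * M :=
      (Nat.cast_le.2 (min_le_left _ _)).trans (Nat.floor_le hαM)
    have h2 : α j * M - 1 ≤ ((min ⌊α j * M⌋₊ (M - 1) : ℕ) : ℝ) := by
      rcases min_choice ⌊α j * M⌋₊ (M - 1) with h | h <;> rw [h]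
      · linarith [Nat.lt_floor_add_one (α j * M)]
      · rw [Nat.cast_sub hM, Nat.cast_one]
        linarith [mul_le_of_le_one_left hM0.le (hα j).2]
    have hk0 : (0 : ℝ) ≤ k := Nat.cast_nonneg _
    have hj0 : (0 : ℝ) ≤ (j : ℕ) := Nat.cast_nonneg _
    have hjk : ((j : ℕ) : ℝ) ≤ k := by exact_mod_cast hj.le
    have h3 := mul_le_mul_of_nonneg_left h1 hk0
    have h4 := mul_le_mul_of_nonneg_left h2 hk0
    rw [hloc]
    push_cast at h3 h4 ⊢
    rw [abs_le]
    constructor <;> nlinarith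

theorem cast_sub_add_sub (a b : ℕ) : (((a - b) + (b - a) : ℕ) : ℝ) = |(a : ℝ) - b| := by
  rcases le_total a b with h | h
  · rw [Nat.sub_eq_zero_of_le h, zero_add, Nat.cast_sub h, abs_sub_comm, abs_of_nonneg]
    exact sub_nonneg.2 (Nat.cast_le.2 h)
  · rw [Nat.sub_eq_zero_of_le h, add_zero, Nat.cast_sub h, abs_of_nonneg]
    exact sub_nonneg.2 (Nat.cast_le.2 h)

/-- The integer test is the real inequality multiplied by `N * M * (k * M) ^ i`. The tolerance `7 *
k ^ 2 / M` leaves room for `4 * k ^ 2 / M` from rounding the source and `3 / M` from the sample. -/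
theorem defect_lt_one_iff {k N M : ℕ} {x : ℕ → ℝ} {c : ℕ} (hk : 0 < k) (hN : 0 < N) (hM : 0 < M) :
    defect k N M x c < 1 ↔ ∑ j ∈ Finset.range k, weight M c j = M ∧ ∀ i < 2 * k,
      |(moment k M c i : ℝ) / (M * (k * M) ^ i) -
        (sampleMoment k N (k * M) x i : ℝ) / (N * (k * M) ^ i)| ≤ 7 * k ^ 2 / M := by
  have hk' : (0 : ℝ) < k := by exact_mod_cast hk
  have hN' : (0 : ℝ) < N := by exact_mod_cast hN
  have hM' : (0 : ℝ) < M := by exact_mod_cast hM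
  rw [defect, Nat.lt_one_iff, Nat.add_eq_zero_iff]
  refine and_congr (by omega) ?_
  rw [Finset.sum_eq_zero_iff]
  simp only [Finset.mem_range, ite_eq_right_iff, one_ne_zero, imp_false, not_lt]
  refine forall_congr' fun i => imp_congr_right fun _ => ?_
  rw [← Nat.cast_le (α := ℝ), cast_sub_add_sub]
  push_cast
  have e : (moment k M c i : ℝ) / (M * (k * M) ^ i) -
      (sampleMoment k N (k * M) x i : ℝ) / (N * (k * M) ^ i) =
      (N * moment k M c i - M * sampleMoment k N (k * M) x i) / (N * M * (k * M) ^ i) := by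
    field_simp
  rw [e, abs_div, abs_of_pos (show (0 : ℝ) < N * M * (k * M) ^ i by positivity),
    div_le_div_iff₀ (by positivity) hM']
  rw [show (7 : ℝ) * k ^ 2 * (N * M * (k * M) ^ i) = 7 * (k * (k * (N * (k * M) ^ i))) * M by ring]
  exact (mul_le_mul_iff_of_pos_right hM').symm

/-- The `k` weights are each off by at most `2 * k / M`. The locations are off by at most `1 / M`,
which changes an `i`-th power by at most `2 * k / M`, and this is averaged over `w`. -/
theorem abs_moment_sub_le {k M c i : ℕ} (hk : 0 < k) (hM : 0 < M) (hi : i ≤ 2 * k)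
    {w α : Fin k → ℝ} (hw : w ∈ stdSimplex ℝ (Fin k)) (hα : ∀ j, α j ∈ Icc (0 : ℝ) 1)
    (hloc : ∀ j : Fin k, location k M c j ≤ k * M)
    (hcw : ∀ j : Fin k, |(weight M c j : ℝ) - M * w j| ≤ 2 * k)
    (hcα : ∀ j : Fin k, |(location k M c j : ℝ) - k * M * α j| ≤ k) :
    |(moment k M c i : ℝ) / (M * (k * M) ^ i) - ∑ j, w j * α j ^ i| ≤ 4 * k ^ 2 / M := by
  have hk' : (0 : ℝ) < k := by exact_mod_cast hk
  have hM' : (0 : ℝ) < M := by exact_mod_cast hM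
  have hk1 : (1 : ℝ) ≤ k := by exact_mod_cast hk
  have e : (moment k M c i : ℝ) / (M * (k * M) ^ i) =
      ∑ j : Fin k, (weight M c j : ℝ) / M * (location k M c j / (k * M)) ^ i := by
    rw [moment, Finset.sum_range, Nat.cast_sum, Finset.sum_div]
    refine Finset.sum_congr rfl fun j _ => ?_
    push_cast
    rw [div_pow, div_mul_div_comm]
  have hi' : (i : ℝ) ≤ 2 * k := by exact_mod_cast hi
  rw [e, ← Finset.sum_sub_distrib]
  calc _ ≤ ∑ j, (2 * (k : ℝ) / M + w j * (2 * k / M)) := by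
        refine (Finset.abs_sum_le_sum_abs _ _).trans (Finset.sum_le_sum fun j _ => ?_)
        set y : ℝ := location k M c j / (k * M) with hy
        have hy1 : y ∈ Icc (0 : ℝ) 1 := ⟨by positivity, by
          rw [hy, div_le_one (by positivity)]; exact_mod_cast hloc j⟩
        have hya : |y - α j| ≤ 1 / M := by
          rw [hy, div_sub' (by positivity), abs_div,
            abs_of_pos (show (0 : ℝ) < k * M by positivity),
            div_le_div_iff₀ (by positivity) hM']
          nlinarith [hcα j]
        have hp := abs_pow_sub_pow_le_mul hy1 (hα j) hya i
        have hu : |(weight M c j : ℝ) / M - w j| ≤ 2 * k / M := by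
          rw [div_sub' hM'.ne', abs_div, abs_of_pos hM']
          exact div_le_div_of_nonneg_right (hcw j) hM'.le
        calc |(weight M c j : ℝ) / M * y ^ i - w j * α j ^ i|
            = |((weight M c j : ℝ) / M - w j) * y ^ i + w j * (y ^ i - α j ^ i)| := by ring_nf
          _ ≤ |(weight M c j : ℝ) / M - w j| * |y ^ i| + |w j| * |y ^ i - α j ^ i| := by
            rw [← abs_mul, ← abs_mul]; exact abs_add_le _ _
          _ ≤ 2 * k / M * 1 + w j * (2 * k / M) := by
            rw [abs_of_nonneg (pow_nonneg hy1.1 i), abs_of_nonneg (hw.1 j)]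
            have h1 : (i : ℝ) * (1 / M) ≤ 2 * k / M := by
              rw [mul_one_div]; exact div_le_div_of_nonneg_right hi' hM'.le
            have h2 := hw.1 j
            gcongr
            · exact pow_le_one₀ hy1.1 hy1.2
            · exact hp.trans h1
          _ = _ := by ring
    _ = (2 * k * k + 2 * k) / M := by
        rw [Finset.sum_add_distrib, ← Finset.sum_mul, hw.2]
        simp only [Finset.sum_const, Finset.card_univ, Fintype.card_fin, nsmul_eq_mul]
        ring
    _ ≤ 4 * k ^ 2 / M := by
        gcongr
        nlinarith

end SpikeSearch

/-! ### Error analysis of the output -/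

namespace RAM

open SpikeSearch

theorem realInput_le_one {N m : ℕ} (s ψ : ℝ) (z : Fin N → Fin m → unitInterval) (n : ℕ) :
    realInput s ψ z (n + 2) ≤ 1 := by
  simp only [realInput]
  split_ifs
  · exact (z _ _).2.2
  · exact zero_le_one

theorem realInput_eq {N m : ℕ} (s ψ : ℝ) (z : Fin N → Fin m → unitInterval) (a : Fin N)
    (l : Fin m) : realInput s ψ z (2 + (a * m + l)) = z a l := by
  have hm : 0 < m := l.pos
  have h1 : (a * m + l : ℕ) / m = a := by
    rw [mul_comm, Nat.mul_add_div hm, Nat.div_eq_of_lt l.2, add_zero]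
  have h2 : (a * m + l : ℕ) % m = l := by
    rw [mul_comm, Nat.mul_add_mod, Nat.mod_eq_of_lt l.2]
  rw [add_comm 2]
  simp only [realInput, h1, h2]
  rw [dif_pos ⟨a.2, l.2⟩]

theorem abs_sampleMoment_sub_le {k N R i : ℕ} (hR : 0 < R) (hN : 0 < N) (hi : i ≤ 2 * k - 1)
    (s ψ : ℝ) (z : Fin N → Fin (2 * k - 1) → unitInterval) :
    |(sampleMoment k N R (realInput s ψ z) i : ℝ) / (N * R ^ i) - (∑ a, prefixProd i (z a)) / N| ≤
      i / R := by
  have hR' : (0 : ℝ) < R := by exact_mod_cast hR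
  have hN' : (0 : ℝ) < N := by exact_mod_cast hN
  set x := realInput s ψ z
  have e1 : (sampleMoment k N R x i : ℝ) / (N * R ^ i) = (∑ a : Fin N, ∏ l ∈ Finset.range i,
      (⌊(R : ℝ) * x (2 + (a * (2 * k - 1) + l))⌋₊ : ℝ) / R) / N := by
    rw [sampleMoment, Finset.sum_range, mul_comm (N : ℝ), ← div_div, Nat.cast_sum, Finset.sum_div]
    simp [Finset.prod_div_distrib]
  have e2 : ∀ a : Fin N, prefixProd i (z a) =
      ∏ l ∈ Finset.range i, x (2 + (a * (2 * k - 1) + l)) := fun a => by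
    have h1 : prefixProd i (z a) = ∏ l : Fin (2 * k - 1),
        if (l : ℕ) < i then x (2 + (a * (2 * k - 1) + l)) else 1 :=
      Finset.prod_congr rfl fun l _ => by rw [← realInput_eq s ψ z a l]
    rw [h1, Fin.prod_univ_eq_prod_range
      (fun l => if l < i then x (2 + (a * (2 * k - 1) + l)) else 1), ← Finset.prod_filter]
    congr 1
    ext
    simp only [Finset.mem_filter, Finset.mem_range]
    omega
  have hx : ∀ (a : Fin N), ∀ l < i, x (2 + (a * (2 * k - 1) + l)) ∈ Icc (0 : ℝ) 1 :=
    fun a l hl => by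
      have := realInput_eq s ψ z a ⟨l, by omega⟩
      simp only [x, this]
      exact (z _ _).2
  rw [e1, ← sub_div, ← Finset.sum_sub_distrib, abs_div, abs_of_pos hN', div_le_iff₀ hN']
  refine (Finset.abs_sum_le_sum_abs _ _).trans ?_
  refine (Finset.sum_le_card_nsmul _ _ ((i : ℝ) / R) fun a _ => ?_).trans (by simp [mul_comm])
  rw [e2, div_eq_mul_one_div]
  refine abs_prod_sub_prod_le (fun l hl => ?_) (hx a) fun l hl => ?_
  · have h := Nat.floor_le (mul_nonneg hR'.le (hx a l hl).1)
    refine ⟨by positivity, ?_⟩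
    rw [div_le_one hR']
    exact h.trans (mul_le_of_le_one_right hR'.le (hx a l hl).2)
  · have h := Nat.floor_le (mul_nonneg hR'.le (hx a l hl).1)
    have h' := Nat.lt_floor_add_one ((R : ℝ) * x (2 + (a * (2 * k - 1) + l)))
    rw [div_sub' hR'.ne', abs_div, abs_of_pos hR']
    refine div_le_div_of_nonneg_right ?_ hR'.le
    rw [abs_le]
    constructor <;> linarith

/-- Positivity and distinctness are built into the encoding: weights are digits plus one, and the
numerator of location `j` is congruent to `j` modulo `k`. The total weight is part of the defect,
and the fallback covers inputs without an admissible candidate. -/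
theorem isSpikeDistribution_output {k N : ℕ} (hk : 0 < k) (x : ℕ → ℝ) :
    IsSpikeDistribution (fun j : Fin k => (output k N x (1 + j) : ℝ) / output k N x 0)
      fun j : Fin k => (output k N x (1 + k + j) : ℝ) / output k N x 0 := by
  have hk' : (0 : ℝ) < k := by exact_mod_cast hk
  have hM' : (0 : ℝ) < gridSize N x := by exact_mod_cast gridSize_pos
  have hidx : ∀ j : Fin k, ¬ 1 + (j : ℕ) < 1 ∧ 1 + (j : ℕ) < k + 1 ∧ ¬ 1 + k + (j : ℕ) < 1 ∧
      ¬ 1 + k + (j : ℕ) < k + 1 ∧ 1 + (j : ℕ) - 1 = j ∧ 1 + k + (j : ℕ) - (k + 1) = j :=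
    fun j => by omega
  by_cases hd : defect k N (gridSize N x) x (best k N x) < 1
  · have hsum : ∑ j ∈ Finset.range k, weight (gridSize N x) (best k N x) j = gridSize N x := by
      rw [defect, Nat.lt_one_iff] at hd
      omega
    simp only [output, hd, if_true, hidx, if_false, zero_lt_one]
    refine ⟨fun j => ?_, ?_, fun j j' h => ?_, fun j => ⟨by positivity, ?_⟩⟩
    · have : 0 < weight (gridSize N x) (best k N x) j := Nat.succ_pos _
      have hM : 0 < gridSize N x := gridSize_pos
      positivity
    · rw [← Finset.sum_div, ← Nat.cast_sum, ← Finset.mul_sum,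
        Fin.sum_univ_eq_sum_range fun j => weight (gridSize N x) (best k N x) j, hsum]
      exact div_self (by push_cast; positivity)
    · rw [div_left_inj' (by push_cast; positivity), Nat.cast_inj] at h
      have := congrArg (· % k) h
      simp only [location, Nat.mul_add_mod, Nat.mod_eq_of_lt j.2, Nat.mod_eq_of_lt j'.2] at this
      exact Fin.ext this
    · rw [div_le_one (by push_cast; positivity)]
      exact_mod_cast (location_lt (best k N x) j.2).le
  · simp only [output, hd, if_false, hidx, if_true, zero_lt_one]
    refine ⟨fun j => by push_cast; positivity, ?_, fun j j' h => ?_, fun j => ⟨by positivity, ?_⟩⟩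
    · simp [hk'.ne']
    · rw [div_left_inj' hk'.ne', Nat.cast_inj] at h
      exact Fin.ext h
    · rw [div_le_one hk']
      exact_mod_cast j.2.le

/-- If the empirical moments are good, and the grid is fine but the sample is so large that all
candidates are enumerated, then the output has almost the right moments. -/
theorem abs_output_moment_sub_le {k N : ℕ} (hk : 0 < k) {s ψ ε : ℝ} (θ : MixtureSource k)
    {z : Fin N → Fin (2 * k - 1) → unitInterval} (hz : z ∈ θ.goodEvent (2 * k - 1) N (2 * k) ε)
    (hkM : k ≤ gridSize N (realInput s ψ z))
    (hMN : 2 * gridSize N (realInput s ψ z) ^ (2 * k) ≤ N)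
    (hε : ε ≤ 1 / gridSize N (realInput s ψ z)) {i : ℕ} (hi : i < 2 * k) :
    |∑ j, θ.weight j * θ.mean j ^ i - ∑ j : Fin k, (output k N (realInput s ψ z) (1 + j) : ℝ) /
        output k N (realInput s ψ z) 0 * ((output k N (realInput s ψ z) (1 + k + j) : ℝ) /
        output k N (realInput s ψ z) 0) ^ i| ≤ 10 * k ^ 2 / gridSize N (realInput s ψ z) := by
  set x := realInput s ψ z with hx
  set M := gridSize N x with hMdef
  have hM : 0 < M := gridSize_pos
  have hN : 0 < N := lt_of_lt_of_le (by positivity) hMN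
  have hk' : (0 : ℝ) < k := by exact_mod_cast hk
  have hk1 : (1 : ℝ) ≤ k := by exact_mod_cast hk
  have hN' : (0 : ℝ) < N := by exact_mod_cast hN
  have hM' : (0 : ℝ) < M := by exact_mod_cast hM
  have hsample : ∀ i < 2 * k, |(sampleMoment k N (k * M) x i : ℝ) / (N * (k * M) ^ i) -
      ∑ j, θ.weight j * θ.mean j ^ i| ≤ 3 / M := fun i hi => by
    have h1 := abs_sampleMoment_sub_le (k := k) (R := k * M) (i := i) (by positivity) hN (by omega)
      s ψ z
    rw [← hx] at h1
    have h2 := hz i hi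
    have h3 : |(∑ a, prefixProd i (z a)) / N - ∑ j, θ.weight j * θ.mean j ^ i| ≤ 1 / M := by
      rw [div_sub' hN'.ne', abs_div, abs_of_pos hN', div_le_iff₀ hN']
      refine h2.trans ?_
      rw [mul_comm]
      exact mul_le_mul_of_nonneg_right hε hN'.le
    have h4 : (i : ℝ) / ((k * M : ℕ) : ℝ) ≤ 2 / M := by
      have : (i : ℝ) ≤ 2 * k := by exact_mod_cast hi.le
      push_cast
      rw [div_le_div_iff₀ (by positivity) hM']
      nlinarith
    push_cast at h1 h4
    calc _ ≤ _ := abs_sub_le _ ((∑ a, prefixProd i (z a)) / N) _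
      _ ≤ 2 / M + 1 / M := add_le_add (h1.trans h4) h3
      _ = 3 / M := by ring
  obtain ⟨c, hc0, hcM, hcs, hcw, hcα⟩ := exists_candidate hkM hk θ.weight_mem θ.mean_mem_Icc
  have hc : defect k N M x c < 1 := by
    rw [defect_lt_one_iff hk hN hM]
    refine ⟨hcs, fun i hi => ?_⟩
    have h1 := abs_moment_sub_le hk hM hi.le θ.weight_mem θ.mean_mem_Icc
      (fun j => (location_lt c j.2).le) hcw hcα
    have h2 := hsample i hi
    rw [abs_sub_comm] at h2
    refine (abs_sub_le _ _ _).trans ((add_le_add h1 h2).trans ?_)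
    rw [← add_div]
    gcongr
    nlinarith
  -- The rounded source `c` lies in the search range, so the search does not end in its default
  -- value with a defect.
  have hbest : defect k N M x (best k N x) < 1 :=
    Nat.findGreatest_spec (P := fun c => defect k N (gridSize N x) x c < 1)
      (hcM.le.trans hMN) hc
  have hb := ((defect_lt_one_iff hk hN hM).1 hbest).2 i hi
  have hidx : ∀ j : Fin k, ¬ 1 + (j : ℕ) < 1 ∧ 1 + (j : ℕ) < k + 1 ∧ ¬ 1 + k + (j : ℕ) < 1 ∧
      ¬ 1 + k + (j : ℕ) < k + 1 ∧ 1 + (j : ℕ) - 1 = j ∧ 1 + k + (j : ℕ) - (k + 1) = j :=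
    fun j => by omega
  have e : ∑ j : Fin k, (output k N x (1 + j) : ℝ) / output k N x 0 *
      ((output k N x (1 + k + j) : ℝ) / output k N x 0) ^ i =
      (moment k M (best k N x) i : ℝ) / (M * (k * M) ^ i) := by
    simp only [output, ← hMdef, hbest, if_true, hidx, if_false, zero_lt_one]
    rw [moment, Finset.sum_range, Nat.cast_sum, Finset.sum_div]
    refine Finset.sum_congr rfl fun j _ => ?_
    push_cast
    rw [div_pow]
    field_simp
  rw [e]
  have h2 := hsample i hi
  rw [abs_sub_comm] at h2 hb
  refine (abs_sub_le _ _ _).trans ((add_le_add h2 hb).trans ?_)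
  rw [← add_div]
  gcongr
  nlinarith

end RAM

/-! ### The main theorem -/

/-! ### Choice of the parameters -/

namespace SpikeSearch

/-- If `N * s ≥ 1`, the cap `N` on the search is not reached, and the grid size is the least `M`
with `M * s ≥ 1`. -/
theorem gridSize_bounds {N : ℕ} {x : ℕ → ℝ} (hs : 0 < x 0) (hN : 1 ≤ N * x 0) :
    1 ≤ gridSize N x * x 0 ∧ gridSize N x * x 0 ≤ 1 + x 0 := by
  set g := Nat.findGreatest (fun m => ⌊(m : ℝ) * x 0⌋₊ < 1) N with hg
  have hM : gridSize N x = g + 1 := rfl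
  have hP : ⌊(g : ℝ) * x 0⌋₊ < 1 :=
    Nat.findGreatest_spec (P := fun m => ⌊(m : ℝ) * x 0⌋₊ < 1) (Nat.zero_le N) (by simp)
  rw [Nat.floor_lt (by positivity), Nat.cast_one] at hP
  have hgN : g + 1 ≤ N := by
    refine Nat.lt_of_le_of_ne (Nat.findGreatest_le N) fun h => ?_
    rw [h] at hP
    linarith
  have hnP := Nat.findGreatest_is_greatest (P := fun m => ⌊(m : ℝ) * x 0⌋₊ < 1)
    (show g < g + 1 by omega) hgN
  rw [Nat.floor_lt (by positivity), Nat.cast_one, not_lt] at hnP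
  rw [hM]
  refine ⟨hnP, ?_⟩
  push_cast
  linarith

end SpikeSearch

/-- The sample size has two tasks: to exceed the code of the rounded source, and to make each of the
`2 * k` two-sided Hoeffding tails at most `ψ / (2 * k)`. With `Y = (2 / s) ^ (2 * k)` it is at least
`3 * k * Y ^ 2 * ℓ`, and `ℓ ≥ 1` since `4 * k / ψ > 4 > e`. -/
theorem snapshotCount_bounds {k : ℕ} {s ψ : ℝ} (hk : 0 < k) (hs : 0 < s) (hs1 : s ≤ 1)
    (hψ : 0 < ψ) (hψ1 : ψ < 1) :
    2 * (2 / s) ^ (2 * k) ≤ snapshotCount k s ψ ∧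
      (2 * k : ℕ) * (2 * Real.exp (-(2 * snapshotCount k s ψ * ((s / 2) ^ (2 * k)) ^ 2))) ≤ ψ := by
  have hk' : (0 : ℝ) < k := by exact_mod_cast hk
  have hk1 : (1 : ℝ) ≤ k := by exact_mod_cast hk
  set N := snapshotCount k s ψ
  set ℓ := Real.log (4 * (k : ℝ) / ψ) with hℓ
  have hy : 1 ≤ 2 / s := by rw [le_div_iff₀ hs]; linarith
  have hℓ1 : 1 ≤ ℓ := by
    have h1 : Real.exp 1 ≤ 4 * k / ψ := by
      rw [le_div_iff₀ hψ]
      nlinarith [Real.exp_one_lt_d9]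
    simpa using Real.log_le_log (Real.exp_pos 1) h1
  have hNle : 3 * k * ((2 / s) ^ (2 * k)) ^ 2 * ℓ ≤ N := by
    have h := Nat.le_ceil (3 * (k : ℝ) * 2 ^ (4 * k) * (s ^ (4 * k))⁻¹ * ℓ)
    refine le_trans (le_of_eq ?_) h
    rw [← pow_mul, show 2 * k * 2 = 4 * k by ring, div_pow]
    ring
  set Y := (2 / s) ^ (2 * k) with hY
  have hY1 : 1 ≤ Y := one_le_pow₀ hy
  have hYY : Y ≤ Y ^ 2 := by nlinarith
  constructor
  · refine le_trans ?_ hNle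
    calc 2 * Y ≤ 3 * 1 * Y ^ 2 * 1 := by nlinarith
      _ ≤ 3 * k * Y ^ 2 * ℓ := by gcongr
  · have hε : (s / 2) ^ (2 * k) = Y⁻¹ := by rw [hY, ← inv_pow, inv_div]
    have h1 : ℓ ≤ 2 * N * ((s / 2) ^ (2 * k)) ^ 2 := by
      rw [hε, inv_pow, ← div_eq_mul_inv, le_div_iff₀ (by positivity)]
      calc ℓ * Y ^ 2 ≤ 2 * (3 * k * Y ^ 2 * ℓ) := by
            have h : 0 < Y ^ 2 * ℓ := by positivity
            nlinarith [mul_nonneg h.le (sub_nonneg.2 hk1)]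
        _ ≤ 2 * (N : ℝ) := by linarith
    have h2 : Real.exp (-(2 * N * ((s / 2) ^ (2 * k)) ^ 2)) ≤ ψ / (4 * k) := by
      refine (Real.exp_le_exp.2 (neg_le_neg h1)).trans (le_of_eq ?_)
      rw [Real.exp_neg, hℓ, Real.exp_log (by positivity), inv_div]
    calc _ ≤ ((2 * k : ℕ) : ℝ) * (2 * (ψ / (4 * k))) := by gcongr
      _ = ψ := by push_cast; field_simp; norm_num

/-- Distributions with `k` spikes and moments of order less than `2 * k` that differ by
`O(k ^ 2 s)` have transportation distance `O(k s ^ (1 / (4 * k)))`. -/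
theorem transportDist_le_of_moments {k : ℕ} (hk : 0 < k) {w α v β : Fin k → ℝ}
    (hw : w ∈ stdSimplex ℝ (Fin k)) (hv : v ∈ stdSimplex ℝ (Fin k))
    (hα : ∀ i, α i ∈ Icc (0 : ℝ) 1) (hβ : ∀ j, β j ∈ Icc (0 : ℝ) 1) {σ : ℝ} (hσ : 0 < σ)
    (hσk : 1024 * k * σ ≤ 1)
    (hm : ∀ i < 2 * k, |∑ j, w j * α j ^ i - ∑ j, v j * β j ^ i| ≤ 10 * k ^ 2 * σ ^ (4 * k)) :
    transportDist w α v β ≤ 1024 * k * σ := by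
  have hk1 : (1 : ℝ) ≤ k := by exact_mod_cast hk
  have hkσ : σ ≤ k * σ := le_mul_of_one_le_left hσ.le hk1
  have hσ1 : σ ≤ 1 := by linarith
  -- With `γ = 256 * σ` the coefficient bound costs `(64 * σ) ^ (-2 * k)`. This leaves `σ ^ (2 *
  -- k)`, and `64 ^ (2 * k) = 4096 ^ k` absorbs `20 * k ^ 3`. The windows around the atoms
  -- contribute `512 * k * σ`.
  set D : ℝ := (2 * k : ℕ) * ((4 / (256 * σ)) ^ (2 * k) * (10 * k ^ 2 * σ ^ (4 * k))) with hD
  have hDσ : D ≤ σ := by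
    have h1 : (4 / (256 * σ)) ^ (2 * k) * σ ^ (4 * k) = σ ^ (2 * k) / 4096 ^ k := by
      rw [show 4 / (256 * σ) = (64 * σ)⁻¹ by field_simp; norm_num, inv_pow, mul_pow,
        show 4 * k = 2 * k + 2 * k by ring, pow_add, pow_mul 64]
      norm_num
      field_simp
    have h2 : (20 * k ^ 3 : ℝ) ≤ 4096 ^ k := by
      have h4 : 20 * k ^ 3 ≤ 4096 ^ k := by
        have h5 : k + 1 ≤ 2 ^ k := Nat.lt_two_pow_self
        calc 20 * k ^ 3 ≤ 512 ^ k * (2 ^ k) ^ 3 :=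
              Nat.mul_le_mul ((by norm_num : 20 ≤ 512 ^ 1).trans
                (Nat.pow_le_pow_right (by norm_num) hk)) (Nat.pow_le_pow_left (by omega) 3)
          _ = 4096 ^ k := by rw [← pow_mul, mul_comm k, pow_mul, ← mul_pow]; norm_num
      exact_mod_cast h4
    have h3 : D = 20 * k ^ 3 * (σ ^ (2 * k) / 4096 ^ k) := by
      rw [hD, ← h1]
      push_cast
      ring
    rw [h3, mul_div_assoc', div_le_iff₀ (by positivity), mul_comm]
    exact mul_le_mul (pow_le_of_le_one hσ.le hσ1 (by omega)) h2 (by positivity) hσ.le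
  have h := transportDist_le_of_cdf hw hv hα hβ (D := D) (γ := 256 * σ) (by positivity)
    (by positivity) fun t htα htβ => abs_cdf_sub_cdf_le (n := 2 * k) (by omega) hα hβ
      (by positivity) (by linarith) htα htβ hm
  calc _ ≤ _ := h
    _ ≤ σ + (k + k) * (256 * σ) := by gcongr
    _ ≤ 1024 * k * σ := by nlinarith

theorem theorem5p1 :
    ∃ (prog : RAM.Prog) (P : Polynomial ℕ),
      ∀ (k : ℕ) (s ψ : ℝ), 0 < k → 0 < s → 0 < ψ →
        ∃ w α : (Fin (snapshotCount k s ψ) → Fin (2 * k - 1) → unitInterval) → Fin k → ℝ,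
          RAM.ComputesWithin prog (P.eval (k + snapshotCount k s ψ)) k (snapshotCount k s ψ)
            (2 * k - 1) s ψ w α ∧
          (∀ z, IsSpikeDistribution (w z) (α z)) ∧
          ∀ θ : MixtureSource k, ENNReal.ofReal s < θ.separation →
            ∃ E : Set (Fin (snapshotCount k s ψ) → Fin (2 * k - 1) → unitInterval),
              MeasurableSet E ∧
              ENNReal.ofReal (1 - ψ) ≤ θ.sampleLaw (2 * k - 1) (snapshotCount k s ψ) E ∧
              ∀ z ∈ E, transportDist θ.weight θ.mean (w z) (α z) ≤
                1024 * (k : ℝ) * s ^ (1 / (4 * (k : ℝ))) := by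
  obtain ⟨P, hP⟩ := RAM.exists_learnProg_runs
  refine ⟨RAM.learnProg, P, fun k s ψ hk hs hψ => ?_⟩
  set N := snapshotCount k s ψ with hNdef
  let out (z : Fin N → Fin (2 * k - 1) → unitInterval) : ℕ → ℕ :=
    SpikeSearch.output k N (RAM.realInput s ψ z)
  have hspike : ∀ z, IsSpikeDistribution (fun j : Fin k => (out z (1 + j) : ℝ) / out z 0)
      fun j : Fin k => (out z (1 + k + j) : ℝ) / out z 0 := fun z =>
    RAM.isSpikeDistribution_output hk _
  have hsimplex : ∀ z, (fun j : Fin k => (out z (1 + j) : ℝ) / out z 0) ∈ stdSimplex ℝ (Fin k) :=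
    fun z => ⟨fun j => ((hspike z).1 j).le, (hspike z).2.1⟩
  refine ⟨fun z j => out z (1 + j) / out z 0, fun z j => out z (1 + k + j) / out z 0, fun z => ?_,
    hspike, fun θ _ => ?_⟩
  · obtain ⟨σ, t, ht, hr, hm⟩ := hP (RAM.realInput s ψ z) k N (RAM.realInput_le_one s ψ z)
    refine ⟨σ, t, ht, hr, funext fun j => ?_, funext fun j => ?_⟩
    · rw [RAM.outWeight, hm _ (by omega), hm 0 (by omega)]
    · rw [RAM.outSpike, hm _ (by omega), hm 0 (by omega)]
  have hprob : IsProbabilityMeasure (θ.sampleLaw (2 * k - 1) N) := by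
    unfold MixtureSource.sampleLaw
    infer_instance
  set σ := s ^ (1 / (4 * (k : ℝ))) with hσdef
  have hk' : (0 : ℝ) < k := by exact_mod_cast hk
  have hk1 : (1 : ℝ) ≤ k := by exact_mod_cast hk
  have hσ : 0 < σ := Real.rpow_pos_of_pos hs _
  have hσs : σ ^ (4 * k) = s := by
    rw [hσdef, ← Real.rpow_natCast, ← Real.rpow_mul hs.le]
    push_cast
    rw [one_div_mul_cancel (by positivity), Real.rpow_one]
  -- If the bound exceeds one, it holds for every output; otherwise `s` is small enough for `k ≤ M`
  -- and `γ ≤ 1`.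
  rcases lt_or_ge 1 (1024 * k * σ) with htriv | hσk
  · exact ⟨univ, MeasurableSet.univ, by rw [measure_univ]; simpa using hψ.le, fun z _ =>
      (transportDist_le_one θ.weight_mem (hsimplex z) θ.mean_mem_Icc (hspike z).2.2.2).trans
        htriv.le⟩
  rcases le_or_gt 1 ψ with hψ1 | hψ1
  · exact ⟨∅, MeasurableSet.empty, by simp [hψ1], by simp⟩
  have hσ1 : σ ≤ 1 := by nlinarith
  have hsσ : s ≤ σ := by
    rw [← hσs]
    exact pow_le_of_le_one hσ.le hσ1 (by omega)
  have hks : k * s ≤ 1 := by nlinarith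
  have hs1 : s ≤ 1 := hsσ.trans hσ1
  obtain ⟨hN1, hN2⟩ := snapshotCount_bounds hk hs hs1 hψ hψ1
  rw [← hNdef] at hN1 hN2
  have hy : 1 ≤ 2 / s := by rw [le_div_iff₀ hs]; linarith
  refine ⟨θ.goodEvent (2 * k - 1) N (2 * k) ((s / 2) ^ (2 * k)), θ.measurableSet_goodEvent _ _ _ _,
    (ENNReal.ofReal_le_ofReal (by linarith)).trans
      (θ.ofReal_le_sampleLaw_goodEvent (by omega) N (by positivity)), fun z hz => ?_⟩
  have hNs : 1 ≤ N * s := by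
    have h1 : 2 / s ≤ (2 / s) ^ (2 * k) := le_self_pow₀ hy (by omega)
    have h2 : 2 / s ≤ N := by linarith
    rw [div_le_iff₀ hs] at h2
    linarith
  obtain ⟨hM1, hM2⟩ := SpikeSearch.gridSize_bounds (x := RAM.realInput s ψ z) hs hNs
  change 1 ≤ _ * s at hM1
  change _ * s ≤ 1 + s at hM2
  set M := SpikeSearch.gridSize N (RAM.realInput s ψ z) with hMdef
  have hM : (0 : ℝ) < M := by exact_mod_cast RAM.gridSize_pos
  have hMle : (M : ℝ) ≤ 2 / s := by
    rw [le_div_iff₀ hs]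
    linarith
  have hkM : k ≤ M := by
    have : (k : ℝ) ≤ M := le_of_mul_le_mul_right (hks.trans hM1) hs
    exact_mod_cast this
  have hMN : 2 * M ^ (2 * k) ≤ N := by
    have : 2 * (M : ℝ) ^ (2 * k) ≤ N := le_trans (by gcongr) hN1
    exact_mod_cast this
  -- The sampling accuracy is far finer than the grid, but only accuracy `1 / M` is needed.
  have hε : (s / 2) ^ (2 * k) ≤ 1 / (M : ℝ) := by
    refine (pow_le_of_le_one (by positivity) (by linarith) (by omega)).trans ?_
    rw [div_le_div_iff₀ two_pos hM]
    rw [le_div_iff₀ hs] at hMle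
    linarith
  refine transportDist_le_of_moments hk θ.weight_mem (hsimplex z) θ.mean_mem_Icc (hspike z).2.2.2
    hσ hσk fun i hi => ?_
  refine (RAM.abs_output_moment_sub_le hk θ hz hkM hMN hε hi).trans ?_
  rw [hσs, div_le_iff₀ hM, mul_assoc]
  nlinarith [mul_pos hk' hk']
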